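/- **Setting.** Let $(X_i,Y_i)_{i\ge 1}$ be i.i.d. with $Y_i=f^0(X_i)+\epsilon_i$, $X_i\in\mathcal X\subseteq\mathbb R$. Let $\mathbf F$ be a real vector space of measurable functions with $Ef^2(X_1)<\infty$, and suppose that the target $f^0\in\mathbf F$ minimizes the risk $E(Y_1-f(X_1))^2$ over $f\in\mathbf F$ (for instance, $\epsilon_1$ is centred and independent of $X_1$). Write $\Xi(f)=E(Y_1-f(X_1))^2-E(Y_1-f^0(X_1))^2$ and $E(f-g)^2=E(f(X_1)-g(X_1))^2$, the expectation being over $X_1$ only, so that $E(\hat f-f^0)^2$ is random through $\hat f$. Assume $P(|X_1|\ge x)\le\alpha e^{-\delta x^2}$ and $P(|\epsilon_1|\ge x)\le\alpha e^{-\delta x^2}$ for all $x>0$, with constants $\alpha,\delta>0$, and $\sup_{x\in\mathcal X,|x|\le C}|f^0(x)|\le F_C<\infty$ with $F_C\ge 0$, for all $C>0$. Let $K,G\in\mathbb R$, $L\ge 8$, $d>0$, $\eta>0$ be constants, not depending on $n$. For each $n$ let $\psi_1,\dots,\psi_p\in\mathbf F$, $p=p_n\ge 2$ (the $\psi_j$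 may depend on $n$), $f_\beta=\sum_{j=1}^p\beta_j\psi_j$, $S_\beta=\{j:\beta_j\ne 0\}$, $s_\beta=|S_\beta|$, $\Phi=\{\beta\in\mathbb R^p:\|\beta\|_1\le G\}$. Put $$C_n=\sqrt{\tfrac2\delta\log n},\quad D_n=2(C_n+2F_{C_n}+GK),\quad \lambda_0=dD_n\sqrt{\tfrac{\log p}{n}},\quad 8\lambda_0\le\lambda_1\le L\lambda_0,\quad \lambda_2=\frac{\lambda_1\sqrt{s^*}}{2\|\beta^*\|_2},$$ where $\beta^*\neq 0$ is an oracle for a given collection $\Gamma=\Gamma_n$ of subsets of $\{1,\dots,p\}$, that is, a minimizer over all $\beta\in\Phi$ with $S_\beta\in\Gamma$ of $$3\,\Xi(f_\beta)+2H\!\left(\frac{4\lambda_1\sqrt{s_\beta}+4\lambda_2\|\beta\|_2}{\phi(S_\beta)}\right),\qquad H(v)=\sup_{u\ge 0}\{uv-u^2\}=\frac{v^2}{4},$$ $$\phi^2(S_\beta)=\min\left\{\frac{E f_b^2(X_1)}{\|b_{S_\beta}\|_2^2}:\ b\in\mathbb R^p\setminus\{0\},\ \|b_{S_\beta^c}\|_1\le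 L_n\|b_{S_\beta}\|_2\right\},\quad L_n=3\Big(\sqrt{s_\beta}+\frac{2\lambda_2\|\beta_{S_\beta}\|_2}{\lambda_1}\Big),$$ where in the criterion $\lambda_2$ is either the number above, or the choice $\lambda_1\sqrt{s_\beta}/(2\|\beta\|_2)$ substituted for each $\beta$ (the result holds in both cases). Put $S^*=S_{\beta^*}$, $s^*=|S^*|$, $f^*=f_{\beta^*}$, and let $\phi_*=\phi(S^*)$, formed with $\beta=\beta^*$. Let $\hat f=f_{\hat\beta}$, where $\hat\beta$ minimizes $\frac1n\sum_{i=1}^n(Y_i-f_\beta(X_i))^2+\lambda_1\|\beta\|_1+\lambda_2\|\beta\|_2^2$ over $\beta\in\Phi$. Assume that for all sufficiently large $n$: $\max_j\sup_{x\in\mathcal X}|\psi_j(x)|\le K$; $\frac1n\sum_{i=1}^n\max_jE\psi_j^2(X_i)\le 1$; the matrix $\Sigma=E\psi(X_1)\psi(X_1)'$ has full rank; $\frac{36L^2\lambda_0s^*K}{\eta\phi_*^2}\le 1$; $\sup_{x\in\mathcal X}|f^*(x)-f^0(x)|\le\eta/2$; $\frac32E(f^*-f^0)^2\le\frac{9\lambda_1^2s^*}{\phi_*^2}$;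 and $\phi_*^2\ge\kappa$ for a constant $\kappa>0$. Assume finally $p=O(\exp(n^a))$ and $F_{C_n}=O(n^{\tilde d})$ with $a>0$, $\tilde d\ge 0$. **Claim.** (a) If $s^*=O(n^b)$ with $b\ge 0$ and $a+b+2\tilde d<1$, then, with probability tending to one, $$\limsup_{n\to\infty}E(\hat f-f^0)^2\le 6\limsup_{n\to\infty}E(f^*-f^0)^2,$$ that is, there are events $A_n$ with $P(A_n)\to 1$ and $\limsup_n\sup_{A_n}E(\hat f-f^0)^2\le 6\limsup_nE(f^*-f^0)^2$. (b) Suppose that the target is linear: for all large $n$, $f^0=f_{\beta^0}$ on $\mathcal X$ for some $\beta^0=\beta^0_n\in\Phi$ with $|S_{\beta^0}|$ bounded in $n$ (for $f^0(x)=\theta x$ with $\theta\ne 0$ and the identity among the $\psi_j$ one has $|S_{\beta^0}|=1$), and that $\Gamma_n=\{S_{\beta^0}\}$. If $a+2\tilde d<1$, then $\|\hat\beta-\beta^0\|_1\to 0$ with probability tending to one, that is, there are events $A_n$ with $P(A_n)\to 1$ and $\sup_{A_n}\|\hat\beta-\beta^0\|_1\to 0$. -/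

import Mathlib

open MeasureTheory ProbabilityTheory Filter Topology Asymptotics

noncomputable section

namespace ENet

/-- The `ℓ₁`-norm of a coefficient vector. -/
def l1 {p : ℕ} (β : Fin p → ℝ) : ℝ := ∑ j, |β j|

/-- The `ℓ₂`-norm of a coefficient vector. -/
def l2 {p : ℕ} (β : Fin p → ℝ) : ℝ := Real.sqrt (∑ j, β j ^ 2)

/-- `S_β`, the set of indices of the non-zero coefficients. -/
def supp {p : ℕ} (β : Fin p → ℝ) : Finset (Fin p) := Finset.univ.filter (fun j => β j ≠ 0)

/-- `β_S`: the coordinates outside `S` are set to zero. -/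
def restr {p : ℕ} (S : Finset (Fin p)) (β : Fin p → ℝ) : Fin p → ℝ :=
  fun j => if j ∈ S then β j else 0

/-- The `ℓ₁`-ball `Φ = {β : ‖β‖₁ ≤ G}`. -/
def ball1 (p : ℕ) (G : ℝ) : Set (Fin p → ℝ) := {β | l1 β ≤ G}

/-- `f_β = ∑ j, β_j ψ_j`. -/
def lin {p : ℕ} (ψ : Fin p → ℝ → ℝ) (β : Fin p → ℝ) : ℝ → ℝ := fun x => ∑ j, β j * ψ j x

/-- The convex conjugate `H(v) = sup_{u ≥ 0} (u v - g(u))`. -/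
def conj (g : ℝ → ℝ) (v : ℝ) : ℝ := sSup ((fun u => u * v - g u) '' Set.Ici 0)

/-- A random variable with `P(|V| ≥ x) ≤ α exp(-δ x²)` for all `x > 0`. -/
def SubGauss {Ω : Type*} [MeasurableSpace Ω] (μ : Measure Ω) (V : Ω → ℝ) (α δ : ℝ) : Prop :=
  ∀ x : ℝ, 0 < x → μ.real {ω | x ≤ |V ω|} ≤ α * Real.exp (-δ * x ^ 2)

section Population

variable {Ω : Type*} [MeasurableSpace Ω] (μ : Measure Ω)

/-- Population risk under quadratic loss, `E (Y - f(X))²`. -/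
def risk (X Y : Ω → ℝ) (f : ℝ → ℝ) : ℝ := ∫ ω, (Y ω - f (X ω)) ^ 2 ∂μ

/-- `f₀` is a target in the class `F`: it minimizes the population risk over `F`. -/
def IsTarget (X Y : Ω → ℝ) (F : Set (ℝ → ℝ)) (f₀ : ℝ → ℝ) : Prop :=
  f₀ ∈ F ∧ ∀ f ∈ F, risk μ X Y f₀ ≤ risk μ X Y f

/-- Excess risk `Ξ(f)` over `f₀`. -/
def excess (X Y : Ω → ℝ) (f₀ f : ℝ → ℝ) : ℝ := risk μ X Y f - risk μ X Y f₀

/-- `E (f - g)²`, that is `E (f(X) - g(X))²`. -/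
def mse (X : Ω → ℝ) (f g : ℝ → ℝ) : ℝ := ∫ ω, (f (X ω) - g (X ω)) ^ 2 ∂μ

/-- The population covariance matrix `Σ = E ψ(X) ψ(X)'`. -/
def cov {p : ℕ} (X : Ω → ℝ) (ψ : Fin p → ℝ → ℝ) : Matrix (Fin p) (Fin p) ℝ :=
  Matrix.of (fun j k => ∫ ω, ψ j (X ω) * ψ k (X ω) ∂μ)

/-- The adaptive restricted eigenvalue `φ²(S)` on the cone with constant `c`:
the minimum of `‖f_b‖² / ‖b_S‖₂²` over `b ≠ 0` with `‖b_{Sᶜ}‖₁ ≤ c ‖b_S‖₂`. -/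
def phiSq {p : ℕ} (X : Ω → ℝ) (ψ : Fin p → ℝ → ℝ) (S : Finset (Fin p)) (c : ℝ) : ℝ :=
  sInf {r | ∃ b : Fin p → ℝ, b ≠ 0 ∧ l1 (restr Sᶜ b) ≤ c * l2 (restr S b) ∧
    r = (∫ ω, lin ψ b (X ω) ^ 2 ∂μ) / l2 (restr S b) ^ 2}

end Population

/-- The choice `λ₂ = λ₁ √s_β / (2 ‖β‖₂)`. -/
def lam2 {p : ℕ} (l : ℝ) (β : Fin p → ℝ) : ℝ :=
  l * Real.sqrt ((supp β).card : ℝ) / (2 * l2 β)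

/-- `L_n = 3 (√|S| + 2 λ₂ ‖β_S‖₂ / λ₁)` at `S = S_β`; here `l = λ₁` and `m = λ₂`. -/
def coneC {p : ℕ} (l m : ℝ) (β : Fin p → ℝ) : ℝ :=
  3 * (Real.sqrt ((supp β).card : ℝ) + 2 * m * l2 (restr (supp β) β) / l)

section Oracle

variable {Ω : Type*} [MeasurableSpace Ω] (μ : Measure Ω)

/-- `φ²(S_β)`. -/
def phiSqAt {p : ℕ} (X : Ω → ℝ) (ψ : Fin p → ℝ → ℝ) (l m : ℝ) (β : Fin p → ℝ) : ℝ :=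
  phiSq μ X ψ (supp β) (coneC l m β)

/-- The oracle criterion `3 Ξ(f_β) + 2 H((4 λ₁ √s_β + 4 λ₂ ‖β‖₂) / φ(S_β))`, where `H` is the
convex conjugate of the quadratic margin function `u ↦ u²`. (For a covariance matrix of full rank
`φ(S) > 0` for all non-empty `S`; for `β = 0` the argument of `H` is `0`.) -/
def oracleCrit {p : ℕ} (X Y : Ω → ℝ) (f₀ : ℝ → ℝ) (ψ : Fin p → ℝ → ℝ) (l m : ℝ)
    (β : Fin p → ℝ) : ℝ :=
  3 * excess μ X Y f₀ (lin ψ β) +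
    2 * conj (fun u => u ^ 2)
      ((4 * l * Real.sqrt ((supp β).card : ℝ) + 4 * m * l2 β) /
        Real.sqrt (phiSqAt μ X ψ l m β))

/-- `βs` is an oracle: it minimizes the criterion over all `β ∈ Φ` with `S_β ∈ Γ`. The value of
`λ₂` used for the candidate `β` is `m β`: a constant function `m` is a fixed `λ₂`, and
`m = lam2 l` is the choice `λ₂ = λ₁ √s_β / (2 ‖β‖₂)` substituted into the criterion. -/
def IsOracle {p : ℕ} (X Y : Ω → ℝ) (f₀ : ℝ → ℝ) (ψ : Fin p → ℝ → ℝ) (l : ℝ)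
    (m : (Fin p → ℝ) → ℝ)
    (Φ : Set (Fin p → ℝ)) (Γ : Set (Finset (Fin p))) (βs : Fin p → ℝ) : Prop :=
  βs ∈ Φ ∧ supp βs ∈ Γ ∧
    ∀ β ∈ Φ, supp β ∈ Γ →
      oracleCrit μ X Y f₀ ψ l (m βs) βs ≤ oracleCrit μ X Y f₀ ψ l (m β) β

end Oracle

/-- The elastic net criterion of the sample `(x_i, y_i)`, `i < n`:
`(1/n) ∑ (y_i - f_β(x_i))² + λ₁ ‖β‖₁ + λ₂ ‖β‖₂²`. -/
def enCrit {p : ℕ} (n : ℕ) (x y : ℕ → ℝ) (ψ : Fin p → ℝ → ℝ) (l m : ℝ) (β : Fin p → ℝ) : ℝ :=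
  (1 / (n : ℝ)) * ∑ i ∈ Finset.range n, (y i - lin ψ β (x i)) ^ 2 + l * l1 β + m * l2 β ^ 2

/-- `b` is an elastic net estimate: a minimizer of the criterion over `Φ`. -/
def IsElasticNet {p : ℕ} (n : ℕ) (x y : ℕ → ℝ) (ψ : Fin p → ℝ → ℝ) (l m : ℝ)
    (Φ : Set (Fin p → ℝ)) (b : Fin p → ℝ) : Prop :=
  b ∈ Φ ∧ ∀ β ∈ Φ, enCrit n x y ψ l m b ≤ enCrit n x y ψ l m β

/-- `C_n = √((2/δ) log n)`. -/
def cutoff (δ : ℝ) (n : ℕ) : ℝ := Real.sqrt (2 / δ * Real.log n)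

/-- `λ₀ = d D_n √(log p / n)` with `D_n = 2 (C_n + 2 F_{C_n} + G K)`. -/
def lam0 (d δ G K : ℝ) (FC : ℝ → ℝ) (n p : ℕ) : ℝ :=
  d * (2 * (cutoff δ n + 2 * FC (cutoff δ n) + G * K)) *
    Real.sqrt (Real.log p / n)

end ENet

end

/-! The argument compares `βh` with the oracle `βs` on one event that does not involve the
estimator. There, the empirical noise products `(Y - f*) ψ_j` and the Gram entries `ψ_j ψ_k` all lie
within `τ = λ₁ / (8 (1 + G))` of their means. By ℓ₁/ℓ∞ duality the error in the linear term is at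
most `τ ‖Δ‖₁` and in the quadratic form at most `τ ‖Δ‖₁²`, with `Δ = βh - βs`. As `‖Δ‖₁ ≤ 2 G`, the
ℓ₁ penalty absorbs both.

The deterministic core is `oracle_inequality`: the basic inequality, orthogonality of the target
residual to the class, and the restricted eigenvalue give `E f_Δ² ≲ λ₁² s* / φ²` and `‖Δ‖₁ ≲ λ₁ s* /
φ²`.

The event is likely by `exists_concentration`. Gaussian tails give the errors all exponential
moments, so no truncation is needed, and the functions, although they vary with `n`, share one
envelope `A (1 + |ε|)`, hence one Bernstein constant. Since `D_n → ∞`, the exponent `n τ²`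
eventually exceeds every fixed multiple of `log p`, so a union bound over `p + p²` averages succeeds
for any `d > 0`.

In (a) the growth conditions force `λ₁² s* → 0`; the approximation error of `f*` is of that order
too, so the left-hand side tends to zero. In (b) the oracle has the support of `β⁰`, so its own
distance to `β⁰` is governed by the same restricted eigenvalue. -/

namespace ENet

/-! ### Norms, supports and the two penalties -/

lemma l1_nonneg {p : ℕ} (b : Fin p → ℝ) : 0 ≤ l1 b := Finset.sum_nonneg fun _ _ => abs_nonneg _

lemma l2_nonneg {p : ℕ} (b : Fin p → ℝ) : 0 ≤ l2 b := Real.sqrt_nonneg _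

lemma l2_sq {p : ℕ} (b : Fin p → ℝ) : l2 b ^ 2 = ∑ j, b j ^ 2 :=
  Real.sq_sqrt (Finset.sum_nonneg fun _ _ => sq_nonneg _)

lemma l2_pos {p : ℕ} {b : Fin p → ℝ} (hb : b ≠ 0) : 0 < l2 b := by
  obtain ⟨j, hj⟩ := Function.ne_iff.mp hb
  refine Real.sqrt_pos.mpr (Finset.sum_pos' (fun _ _ => sq_nonneg _) ⟨j, Finset.mem_univ j, ?_⟩)
  exact sq_pos_of_ne_zero hj

lemma l1_sub_le {p : ℕ} (b c : Fin p → ℝ) : l1 (b - c) ≤ l1 b + l1 c := by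
  unfold l1
  rw [← Finset.sum_add_distrib]
  exact Finset.sum_le_sum fun j _ => abs_sub _ _

lemma l1_add_le {p : ℕ} (b c : Fin p → ℝ) : l1 (b + c) ≤ l1 b + l1 c := by
  unfold l1
  rw [← Finset.sum_add_distrib]
  exact Finset.sum_le_sum fun j _ => abs_add_le _ _

lemma l1_restr_add_compl {p : ℕ} (S : Finset (Fin p)) (b : Fin p → ℝ) :
    l1 (restr S b) + l1 (restr Sᶜ b) = l1 b := by
  unfold l1 restr
  rw [← Finset.sum_add_distrib]
  refine Finset.sum_congr rfl fun j _ => ?_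
  by_cases h : j ∈ S <;> simp [h]

lemma restr_supp {p : ℕ} (b : Fin p → ℝ) : restr (supp b) b = b := by
  ext j
  by_cases h : b j = 0 <;> simp [restr, supp, h]

lemma l1_restr_le {p : ℕ} (S : Finset (Fin p)) (b : Fin p → ℝ) :
    l1 (restr S b) ≤ Real.sqrt S.card * l2 (restr S b) := by
  have h1 : l1 (restr S b) = ∑ j ∈ S, |b j| := by
    unfold l1 restr
    rw [← Finset.sum_filter_add_sum_filter_not Finset.univ (· ∈ S)]
    rw [Finset.sum_eq_zero (s := Finset.univ.filter (¬ · ∈ S)), add_zero]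
    · refine Finset.sum_congr (by simp) fun j hj => by simp [hj]
    · intro j hj
      simp [(Finset.mem_filter.mp hj).2]
  have h2 : l2 (restr S b) ^ 2 = ∑ j ∈ S, |b j| ^ 2 := by
    rw [l2_sq]
    unfold restr
    rw [← Finset.sum_filter_add_sum_filter_not Finset.univ (· ∈ S)]
    rw [Finset.sum_eq_zero (s := Finset.univ.filter (¬ · ∈ S)), add_zero]
    · refine Finset.sum_congr (by simp) fun j hj => by simp [hj]
    · intro j hj
      simp [(Finset.mem_filter.mp hj).2]
  refine abs_le_of_sq_le_sq' ?_ (mul_nonneg (Real.sqrt_nonneg _) (l2_nonneg _)) |>.2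
  rw [h1, mul_pow, h2, Real.sq_sqrt (Nat.cast_nonneg _)]
  exact sq_sum_le_card_mul_sum_sq

/-- Decomposability of the `ℓ₁` penalty. -/
lemma l1_sub_l1_le {p : ℕ} (b c : Fin p → ℝ) :
    l1 b - l1 c ≤ l1 (restr (supp b) (c - b)) - l1 (restr (supp b)ᶜ (c - b)) := by
  unfold l1
  rw [← Finset.sum_sub_distrib, ← Finset.sum_sub_distrib]
  refine Finset.sum_le_sum fun j _ => ?_
  by_cases h : b j = 0
  · simp [restr, supp, h]
  · have := abs_sub_abs_le_abs_sub (b j) (c j)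
    rw [abs_sub_comm] at this
    simpa [restr, supp, h] using this

/-- Convexity of the square gives the bound `2 ⟨b, b - c⟩`, and only coordinates in the support of
`b` enter this inner product; Cauchy–Schwarz does the rest. -/
lemma l2_sq_sub_l2_sq_le {p : ℕ} (b c : Fin p → ℝ) :
    l2 b ^ 2 - l2 c ^ 2 ≤ 2 * (l2 b * l2 (restr (supp b) (c - b))) := by
  have hcs := Real.sum_mul_le_sqrt_mul_sqrt Finset.univ b (fun j => -restr (supp b) (c - b) j)
  simp only [neg_sq] at hcs
  refine le_trans ?_ (mul_le_mul_of_nonneg_left hcs zero_le_two)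
  rw [l2_sq, l2_sq, ← Finset.sum_sub_distrib, Finset.mul_sum]
  refine Finset.sum_le_sum fun j _ => ?_
  by_cases h : b j = 0
  · simp only [restr, supp, h]
    nlinarith [sq_nonneg (c j)]
  · simp only [restr, supp, Finset.mem_filter, Finset.mem_univ, h, true_and, not_false_eq_true,
      ne_eq, if_true, Pi.sub_apply]
    nlinarith [sq_nonneg (c j - b j)]

/-- This choice of `λ₂` makes the ridge term cost exactly as much as the lasso term on the support,
so the cone constant becomes a pure multiple of `√s`. -/
lemma lam2_mul_l2 {p : ℕ} {l : ℝ} {b : Fin p → ℝ} (hb : b ≠ 0) :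
    2 * (lam2 l b * l2 b) = l * Real.sqrt (supp b).card := by
  have := (l2_pos hb).ne'
  unfold lam2
  field_simp

lemma coneC_lam2 {p : ℕ} {l : ℝ} (hl : 0 < l) {b : Fin p → ℝ} (hb : b ≠ 0) :
    coneC l (lam2 l b) b = 6 * Real.sqrt (supp b).card := by
  unfold coneC
  rw [restr_supp, mul_assoc, lam2_mul_l2 hb]
  field_simp
  ring

/-! ### Restricted eigenvalue and the deterministic oracle inequality -/

lemma lin_sub {p : ℕ} (ψ : Fin p → ℝ → ℝ) (b c : Fin p → ℝ) (x : ℝ) :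
    lin ψ (b - c) x = lin ψ b x - lin ψ c x := by
  simp [lin, sub_mul, Finset.sum_sub_distrib]

lemma phiSq_mul_le {Ω : Type*} [MeasurableSpace Ω] (μ : Measure Ω) {p : ℕ} (X : Ω → ℝ)
    (ψ : Fin p → ℝ → ℝ) (S : Finset (Fin p)) (c : ℝ) {b : Fin p → ℝ}
    (hb : l1 (restr Sᶜ b) ≤ c * l2 (restr S b)) :
    phiSq μ X ψ S c * l2 (restr S b) ^ 2 ≤ ∫ ω, lin ψ b (X ω) ^ 2 ∂μ := by
  -- If `b` vanishes on `S`, the quotient in the infimum divides by zero and carries no information,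
  -- but the claim is then trivial.
  by_cases h0 : l2 (restr S b) = 0
  · rw [h0]
    simpa using integral_nonneg fun ω => sq_nonneg (lin ψ b (X ω))
  have hb0 : b ≠ 0 := by
    rintro rfl
    exact h0 (by simp [restr, l2])
  rw [← le_div_iff₀ (by positivity)]
  refine csInf_le ⟨0, ?_⟩ ⟨b, hb0, hb, rfl⟩
  rintro _ ⟨b', _, _, rfl⟩
  exact div_nonneg (integral_nonneg fun ω => sq_nonneg _) (sq_nonneg _)

/-- The oracle inequality, in terms of the quadratic form `Q = E f_Δ²`, with `Δ = c - b`, the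
empirical form `Qn`, and the population and empirical noise terms `N` and `Nn`. -/
lemma oracle_inequality {p : ℕ} {b c : Fin p → ℝ} {l τ G φ Q N Qn Nn e : ℝ}
    (hl : 0 < l) (hb : b ≠ 0) (hφ : 0 < φ) (hτ0 : 0 ≤ τ)
    (hbG : l1 b ≤ G) (hcG : l1 c ≤ G) (hτ : τ * (8 * (1 + G)) ≤ l)
    (hbasic : Qn - 2 * Nn + l * l1 c + lam2 l b * l2 c ^ 2 ≤ l * l1 b + lam2 l b * l2 b ^ 2)
    (hQ : Q ≤ Qn + τ * l1 (c - b) ^ 2) (hN : Nn ≤ N + τ * l1 (c - b))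
    (hNe : 2 * N ≤ 2 * e + Q / 2) (he : 3 / 2 * e ≤ 9 * l ^ 2 * (supp b).card / φ)
    (hQ0 : 0 ≤ Q)
    (hre : l1 (restr (supp b)ᶜ (c - b)) ≤
        6 * Real.sqrt (supp b).card * l2 (restr (supp b) (c - b)) →
      φ * l2 (restr (supp b) (c - b)) ^ 2 ≤ Q) :
    Q ≤ 81 * l ^ 2 * (supp b).card / φ ∧ l1 (c - b) ≤ 63 * l * (supp b).card / φ := by
  have hpen1 := l1_sub_l1_le b c
  have hpen2 := l2_sq_sub_l2_sq_le b c
  have hl2b := lam2_mul_l2 (l := l) hb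
  have hm : 0 ≤ lam2 l b := by
    unfold lam2
    have := l2_nonneg b
    positivity
  have hsplit := l1_restr_add_compl (supp b) (c - b)
  have hl1S := l1_restr_le (supp b) (c - b)
  have hΔG := l1_sub_le c b
  have hs : Real.sqrt (supp b).card ^ 2 = (supp b).card := Real.sq_sqrt (Nat.cast_nonneg _)
  have hs0 := Real.sqrt_nonneg ((supp b).card : ℝ)
  have hv0 := l2_nonneg (restr (supp b) (c - b))
  have hu0 := l1_nonneg (restr (supp b)ᶜ (c - b))
  have hΔ0 := l1_nonneg (c - b)
  rw [← hs] at he ⊢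
  set r := Real.sqrt ((supp b).card : ℝ)
  set v := l2 (restr (supp b) (c - b))
  set u := l1 (restr (supp b)ᶜ (c - b))
  set D := l1 (c - b)
  have hridge : lam2 l b * (l2 b ^ 2 - l2 c ^ 2) ≤ l * r * v := by
    calc _ ≤ lam2 l b * (2 * (l2 b * v)) := mul_le_mul_of_nonneg_left hpen2 hm
      _ = 2 * (lam2 l b * l2 b) * v := by ring
      _ = _ := by rw [hl2b]
  have hlasso := mul_le_mul_of_nonneg_left hpen1 hl.le
  -- Both vectors lie in the ℓ₁-ball, so `D ≤ 2 G` makes the quadratic deviation linear in `D`; the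
  -- factor `8 (1 + G)` is chosen to leave `l / 4`.
  have hτD : 2 * τ * D + τ * D ^ 2 ≤ l / 4 * D := by
    have h1 : τ * D ^ 2 ≤ τ * D * (2 * G) := by
      rw [sq, ← mul_assoc]
      exact mul_le_mul_of_nonneg_left (by linarith) (mul_nonneg hτ0 hΔ0)
    have h2 := mul_le_mul_of_nonneg_right hτ hΔ0
    linarith
  have hDle : D ≤ r * v + u := by linarith
  have hD' : l * D ≤ l * (r * v + u) := mul_le_mul_of_nonneg_left hDle hl.le
  have hSl := mul_le_mul_of_nonneg_left hl1S hl.le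
  set y := l ^ 2 * r ^ 2 / φ with hy
  have hy0 : 0 ≤ y := by positivity
  have he' : e ≤ 6 * y := by
    have : 9 * l ^ 2 * r ^ 2 / φ = 9 * y := by rw [hy]; ring
    linarith
  -- The coefficient of `l r v` is 1 from the lasso, 1 from the ridge and 1/4 from the deviations;
  -- that of `l u` is `1 - 1/4`, and `12 y` bounds `2 e`.
  have hmain : Q / 2 + 3 / 4 * (l * u) ≤ 9 / 4 * (l * r * v) + 12 * y := by linarith
  have hx0 : 0 ≤ l * r * v := by positivity
  have hlu : 0 ≤ l * u := by positivity
  have e1 : 81 * l ^ 2 * r ^ 2 / φ = 81 * y := by rw [hy]; ring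
  have e2 : l * (63 * l * r ^ 2 / φ) = 63 * y := by rw [hy]; ring
  rw [e1]
  suffices h : Q ≤ 81 * y ∧ l * D ≤ 63 * y from
    ⟨h.1, le_of_mul_le_mul_left (h.2.trans_eq e2.symm) hl⟩
  -- If the estimation term dominates, `3/4 l u ≤ 9/2 l r v` is exactly the cone condition with
  -- constant 6, and the restricted eigenvalue bounds `v`. Otherwise the approximation term alone
  -- bounds everything.
  rcases le_total (12 * y) (9 / 4 * (l * r * v)) with hc | hc
  · have hcone : u ≤ 6 * r * v := by
      refine le_of_mul_le_mul_left ?_ hl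
      have : l * (6 * r * v) = 6 * (l * r * v) := by ring
      linarith
    have hQv := hre hcone
    have hQx : Q ≤ 9 * (l * r * v) := by linarith
    have hvb : φ * v ≤ 9 * (l * r) := by
      rcases hv0.eq_or_lt with h | h
      · rw [← h, mul_zero]
        positivity
      · refine le_of_mul_le_mul_right ?_ h
        have h1 : φ * v * v = φ * v ^ 2 := by ring
        have h2 : 9 * (l * r) * v = 9 * (l * r * v) := by ring
        linarith
    have hxy : l * r * v ≤ 9 * y := by
      rw [hy, ← mul_div_assoc, le_div_iff₀ hφ]
      have := mul_le_mul_of_nonneg_left hvb (mul_nonneg hl.le hs0)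
      linarith
    refine ⟨by linarith, ?_⟩
    have := mul_le_mul_of_nonneg_left hcone hl.le
    linarith
  · exact ⟨by linarith, by linarith⟩

/-! ### Exponential moments and concentration -/

lemma exp_mul_le {t : ℝ} (ht : |t| ≤ 1) (z : ℝ) :
    Real.exp (t * z) ≤ 1 + t * z + 2 * t ^ 2 * Real.exp (2 * |z|) := by
  -- The Taylor remainder of order two is at most `(t z)² exp |t z|`; the polynomial factor `z²` is
  -- then absorbed into a second exponential.
  have h := Complex.norm_exp_sub_sum_le_norm_mul_exp ((t * z : ℝ) : ℂ) 2
  have e : Complex.exp ((t * z : ℝ) : ℂ) - ∑ m ∈ Finset.range 2, ((t * z : ℝ) : ℂ) ^ m / m.factorial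
      = ((Real.exp (t * z) - (1 + t * z) : ℝ) : ℂ) := by
    simp [Finset.sum_range_succ]
  rw [e, Complex.norm_real, Complex.norm_real, Real.norm_eq_abs, Real.norm_eq_abs, sq_abs] at h
  have h1 := (le_abs_self _).trans h
  have h2 : |t * z| ≤ |z| := by
    rw [abs_mul]
    exact mul_le_of_le_one_left (abs_nonneg z) ht
  have h3 : z ^ 2 ≤ 2 * Real.exp |z| := by
    have := Real.quadratic_le_exp_of_nonneg (abs_nonneg z)
    rw [sq_abs] at this
    linarith [abs_nonneg z]
  have h4 : (t * z) ^ 2 * Real.exp |t * z| ≤ t ^ 2 * (2 * Real.exp |z|) * Real.exp |z| := by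
    rw [mul_pow]
    gcongr
  have h5 : t ^ 2 * (2 * Real.exp |z|) * Real.exp |z| = 2 * t ^ 2 * Real.exp (2 * |z|) := by
    rw [two_mul |z|, Real.exp_add]
    ring
  linarith

section

variable {Ω : Type*} [MeasurableSpace Ω] {μ : Measure Ω}

lemma summable_exp_gauss {δ : ℝ} (hδ : 0 < δ) (r : ℝ) :
    Summable fun k : ℕ => Real.exp (-δ * (k : ℝ) ^ 2 + r * (k + 1)) := by
  have hg : Summable fun k : ℕ => Real.exp (-(k : ℝ)) := Real.summable_exp_neg_nat
  refine summable_of_isBigO_nat hg ?_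
  have hev : ∀ᶠ k : ℕ in atTop, (2 * |r| + 1) / δ ≤ (k : ℝ) ∧ (1 : ℝ) ≤ k :=
    (tendsto_natCast_atTop_atTop.eventually_ge_atTop _).and
      (tendsto_natCast_atTop_atTop.eventually_ge_atTop _)
  refine IsBigO.of_bound 1 ?_
  filter_upwards [hev] with k ⟨hk, hk1⟩
  rw [Real.norm_eq_abs, Real.norm_eq_abs, Real.abs_exp, Real.abs_exp, one_mul, Real.exp_le_exp]
  rw [div_le_iff₀ hδ] at hk
  have h1 := mul_le_mul_of_nonneg_right hk (by linarith : (0 : ℝ) ≤ k)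
  have h2 : r * (k + 1) ≤ |r| * (k + 1) :=
    mul_le_mul_of_nonneg_right (le_abs_self r) (by linarith)
  have h3 : |r| * 1 ≤ |r| * k := mul_le_mul_of_nonneg_left hk1 (abs_nonneg r)
  nlinarith

lemma SubGauss.integrable_exp [IsProbabilityMeasure μ] {V : Ω → ℝ} {α δ : ℝ}
    (h : SubGauss μ V α δ) (hV : Measurable V) (hα : 0 < α) (hδ : 0 < δ) {r : ℝ} (hr : 0 ≤ r) :
    Integrable (fun ω => Real.exp (r * |V ω|)) μ := by
  refine ⟨by fun_prop, ?_⟩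
  have hmeas : ∀ k : ℕ, MeasurableSet {ω | (k : ℝ) ≤ |V ω|} := fun k =>
    measurableSet_le measurable_const hV.abs
  have htail : ∀ k : ℕ, μ {ω | (k : ℝ) ≤ |V ω|} ≤
      ENNReal.ofReal ((α + 1) * Real.exp (-δ * (k : ℝ) ^ 2)) := by
    intro k
    rw [← ofReal_measureReal]
    refine ENNReal.ofReal_le_ofReal ?_
    -- The tail bound is assumed only for positive levels; the extra 1 in `α + 1` covers level zero
    -- by the trivial bound.
    rcases Nat.eq_zero_or_pos k with rfl | hk
    · refine measureReal_le_one.trans ?_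
      simp [hα.le]
    · refine (h k (by exact_mod_cast hk)).trans ?_
      gcongr
      linarith
  calc ∫⁻ ω, ‖Real.exp (r * |V ω|)‖ₑ ∂μ
      ≤ ∫⁻ ω, ∑' k : ℕ, {ω | (k : ℝ) ≤ |V ω|}.indicator
          (fun _ => ENNReal.ofReal (Real.exp (r * (k + 1)))) ω ∂μ := by
        refine lintegral_mono fun ω => ?_
        -- The single layer `k = ⌊|V|⌋` already dominates `exp (r |V|)`.
        refine le_trans ?_ (ENNReal.le_tsum ⌊|V ω|⌋₊)
        have hmem : ω ∈ {ω' | (⌊|V ω|⌋₊ : ℝ) ≤ |V ω'|} := Nat.floor_le (abs_nonneg (V ω))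
        rw [Set.indicator_of_mem hmem,
          Real.enorm_eq_ofReal (Real.exp_nonneg _)]
        have := (Nat.lt_floor_add_one |V ω|).le
        gcongr
    _ = ∑' k : ℕ, ENNReal.ofReal (Real.exp (r * (k + 1))) * μ {ω | (k : ℝ) ≤ |V ω|} := by
        rw [lintegral_tsum fun k => (measurable_const.indicator (hmeas k)).aemeasurable]
        exact tsum_congr fun k => lintegral_indicator_const (hmeas k) _
    _ ≤ ∑' k : ℕ, ENNReal.ofReal ((α + 1) * Real.exp (-δ * (k : ℝ) ^ 2 + r * (k + 1))) := by
        refine ENNReal.tsum_le_tsum fun k => ?_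
        refine (mul_le_mul_right (htail k) _).trans_eq ?_
        rw [← ENNReal.ofReal_mul (Real.exp_nonneg _), Real.exp_add]
        congr 1
        ring
    _ < ⊤ := ((summable_exp_gauss hδ r).mul_left (α + 1)).tsum_ofReal_lt_top

lemma memLp_two_of_exp {V : Ω → ℝ} (hV : Measurable V)
    (hint : ∀ r : ℝ, 0 ≤ r → Integrable (fun ω => Real.exp (r * |V ω|)) μ) :
    MemLp V 2 μ := by
  rw [memLp_two_iff_integrable_sq hV.aestronglyMeasurable]
  refine ((hint 1 zero_le_one).const_mul 2).mono' (by fun_prop) (ae_of_all _ fun ω => ?_)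
  have := Real.quadratic_le_exp_of_nonneg (abs_nonneg (V ω))
  rw [sq_abs] at this
  rw [Real.norm_eq_abs, abs_of_nonneg (sq_nonneg _), one_mul]
  linarith [abs_nonneg (V ω)]

/-- Bernstein-type bound on the moment generating function of a centred variable. -/
lemma mgf_le_of_centered [IsProbabilityMeasure μ] {Z : Ω → ℝ} (hZ : Measurable Z) (hZi : Integrable Z μ)
    (h0 : ∫ ω, Z ω ∂μ = 0) (hexp : Integrable (fun ω => Real.exp (2 * |Z ω|)) μ) {t : ℝ}
    (ht : |t| ≤ 1) :
    Integrable (fun ω => Real.exp (t * Z ω)) μ ∧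
      mgf Z μ t ≤ Real.exp (2 * (∫ ω, Real.exp (2 * |Z ω|) ∂μ) * t ^ 2) := by
  have hi1 : Integrable (fun ω => 1 + t * Z ω) μ := (integrable_const 1).add (hZi.const_mul t)
  have hi : Integrable (fun ω => 1 + t * Z ω + 2 * t ^ 2 * Real.exp (2 * |Z ω|)) μ :=
    hi1.add (hexp.const_mul _)
  have hI : Integrable (fun ω => Real.exp (t * Z ω)) μ := by
    refine hexp.mono' (by fun_prop) (ae_of_all _ fun ω => ?_)
    rw [Real.norm_eq_abs, Real.abs_exp, Real.exp_le_exp]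
    have h1 := le_abs_self (t * Z ω)
    rw [abs_mul] at h1
    have h2 := mul_le_mul_of_nonneg_right ht (abs_nonneg (Z ω))
    linarith [abs_nonneg (Z ω)]
  refine ⟨hI, ?_⟩
  have hint : ∫ ω, (1 + t * Z ω + 2 * t ^ 2 * Real.exp (2 * |Z ω|)) ∂μ
      = 1 + 2 * t ^ 2 * ∫ ω, Real.exp (2 * |Z ω|) ∂μ := by
    rw [integral_add hi1 (hexp.const_mul _),
      integral_add (integrable_const 1) (hZi.const_mul t), integral_const_mul, integral_const_mul,
      h0]
    simp
  calc mgf Z μ t ≤ ∫ ω, (1 + t * Z ω + 2 * t ^ 2 * Real.exp (2 * |Z ω|)) ∂μ :=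
        integral_mono hI hi fun ω => exp_mul_le ht (Z ω)
    _ = 2 * (∫ ω, Real.exp (2 * |Z ω|) ∂μ) * t ^ 2 + 1 := by rw [hint]; ring
    _ ≤ _ := Real.add_one_le_exp _

/-- Chernoff bound for sums of independent variables with a locally sub-Gaussian
moment generating function. -/
lemma measure_sum_ge_le [IsProbabilityMeasure μ] {Z : ℕ → Ω → ℝ} (hind : iIndepFun Z μ)
    (hZ : ∀ i, Measurable (Z i)) {c : ℝ} (hc : 0 < c)
    (hmgf : ∀ i, ∀ t : ℝ, |t| ≤ 1 → Integrable (fun ω => Real.exp (t * Z i ω)) μ ∧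
      mgf (Z i) μ t ≤ Real.exp (c * t ^ 2))
    (n : ℕ) {τ : ℝ} (hτ0 : 0 ≤ τ) (hτ : τ ≤ 2 * c) :
    μ.real {ω | n * τ ≤ |∑ i ∈ Finset.range n, Z i ω|} ≤
      2 * Real.exp (-(n * τ ^ 2 / (4 * c))) := by
  -- This minimizes the Chernoff exponent `-t τ + c t²`; the bound `τ ≤ 2 c` keeps it in the range
  -- where the generating function is controlled.
  set t := τ / (2 * c) with ht
  have ht0 : 0 ≤ t := by positivity
  have ht1 : |t| ≤ 1 := by
    rw [abs_of_nonneg ht0, ht, div_le_one (by positivity)]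
    exact hτ
  have hbound : ∀ s : ℝ, |s| ≤ 1 → mgf (∑ i ∈ Finset.range n, Z i) μ s ≤
      Real.exp (n * (c * s ^ 2)) := by
    intro s hs
    rw [hind.mgf_sum hZ, Real.exp_nat_mul]
    calc _ ≤ ∏ _i ∈ Finset.range n, Real.exp (c * s ^ 2) :=
          Finset.prod_le_prod (fun i _ => mgf_nonneg) fun i _ => (hmgf i s hs).2
      _ = _ := by simp
  have hint : ∀ s : ℝ, |s| ≤ 1 →
      Integrable (fun ω => Real.exp (s * (∑ i ∈ Finset.range n, Z i) ω)) μ := fun s hs =>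
    hind.integrable_exp_mul_sum hZ fun i _ => (hmgf i s hs).1
  have hexp : -t * (n * τ) + n * (c * t ^ 2) = -(n * τ ^ 2 / (4 * c)) := by
    rw [ht]
    field_simp
    ring
  have hup : μ.real {ω | n * τ ≤ (∑ i ∈ Finset.range n, Z i) ω} ≤
      Real.exp (-(n * τ ^ 2 / (4 * c))) := by
    refine (measure_ge_le_exp_mul_mgf _ ht0 (hint t ht1)).trans ?_
    rw [← hexp, Real.exp_add]
    exact mul_le_mul_of_nonneg_left (hbound t ht1) (Real.exp_nonneg _)
  have hlow : μ.real {ω | (∑ i ∈ Finset.range n, Z i) ω ≤ -(n * τ)} ≤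
      Real.exp (-(n * τ ^ 2 / (4 * c))) := by
    have ht1' : |-t| ≤ 1 := by rwa [abs_neg]
    refine (measure_le_le_exp_mul_mgf _ (neg_nonpos.mpr ht0) (hint _ ht1')).trans ?_
    have : -(-t) * (-(n * τ)) = -t * (n * τ) := by ring
    rw [← hexp, Real.exp_add, this]
    refine mul_le_mul_of_nonneg_left ((hbound _ ht1').trans_eq ?_) (Real.exp_nonneg _)
    rw [neg_sq]
  refine (measureReal_mono (s₂ := {ω | n * τ ≤ (∑ i ∈ Finset.range n, Z i) ω} ∪
    {ω | (∑ i ∈ Finset.range n, Z i) ω ≤ -(n * τ)}) fun ω hω => ?_).trans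
    ((measureReal_union_le _ _).trans (by linarith))
  rcases le_abs.mp (show n * τ ≤ |∑ i ∈ Finset.range n, Z i ω| from hω) with h | h
  · left
    simpa using h
  · right
    simp only [Set.mem_ofPred_eq, Finset.sum_apply]
    linarith

/-- Concentration of empirical means, uniformly over functions dominated by `A (1 + |V|)`. -/
lemma exists_concentration [IsProbabilityMeasure μ] {E : Type*} [MeasurableSpace E] {ξ : ℕ → Ω → E}
    (hξ : ∀ i, Measurable (ξ i)) (hind : iIndepFun ξ μ)
    (hid : ∀ i, IdentDistrib (ξ i) (ξ 0) μ μ) {V : Ω → ℝ} (hV : Measurable V)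
    (hint : ∀ r : ℝ, 0 ≤ r → Integrable (fun ω => Real.exp (r * |V ω|)) μ) {A : ℝ} (hA : 0 ≤ A) :
    ∃ c : ℝ, 0 < c ∧ ∀ g : E → ℝ, Measurable g → (∀ ω, |g (ξ 0 ω)| ≤ A * (1 + |V ω|)) →
      ∀ (n : ℕ) (τ : ℝ), 0 ≤ τ → τ ≤ 2 * c →
        μ.real {ω | n * τ ≤ |∑ i ∈ Finset.range n, (g (ξ i ω) - ∫ ω, g (ξ 0 ω) ∂μ)|} ≤
          2 * Real.exp (-(n * τ ^ 2 / (4 * c))) := by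
  have hVi : Integrable (fun ω => A * (1 + |V ω|)) μ :=
    ((integrable_const 1).add ((memLp_two_of_exp hV hint).integrable one_le_two).abs).const_mul A
  set B := ∫ ω, A * (1 + |V ω|) ∂μ with hB
  have hdom : Integrable (fun ω => Real.exp (2 * (A * (1 + |V ω|) + B))) μ := by
    have := (hint (2 * A) (by positivity)).const_mul (Real.exp (2 * A + 2 * B))
    refine this.congr (ae_of_all _ fun ω => ?_)
    simp only [← Real.exp_add]
    congr 1
    ring
  set M := ∫ ω, Real.exp (2 * (A * (1 + |V ω|) + B)) ∂μ with hM
  have hM0 : 0 < M := integral_exp_pos hdom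
  -- The constant depends on the envelope alone, not on `g`: this is what permits dictionaries that
  -- change with `n`.
  refine ⟨2 * M, by positivity, fun g hg hgA n τ hτ0 hτ => ?_⟩
  have hg0 : Integrable (fun ω => g (ξ 0 ω)) μ :=
    hVi.mono' (hg.comp (hξ 0)).aestronglyMeasurable (ae_of_all _ hgA)
  set e := ∫ ω, g (ξ 0 ω) ∂μ with he
  have heB : |e| ≤ B :=
    (abs_integral_le_integral_abs).trans (integral_mono hg0.abs hVi hgA)
  have hgm : Measurable fun x => g x - e := hg.sub_const e
  have hZ0 : ∀ t : ℝ, |t| ≤ 1 → Integrable (fun ω => Real.exp (t * (g (ξ 0 ω) - e))) μ ∧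
      mgf (fun ω => g (ξ 0 ω) - e) μ t ≤ Real.exp (2 * M * t ^ 2) := by
    intro t ht
    have hle : ∀ ω, Real.exp (2 * |g (ξ 0 ω) - e|) ≤ Real.exp (2 * (A * (1 + |V ω|) + B)) := by
      intro ω
      rw [Real.exp_le_exp]
      have := abs_sub (g (ξ 0 ω)) e
      linarith [hgA ω]
    have hm0 : Measurable fun ω => g (ξ 0 ω) - e := hgm.comp (hξ 0)
    have hex : Integrable (fun ω => Real.exp (2 * |g (ξ 0 ω) - e|)) μ :=
      hdom.mono' (hm0.abs.const_mul 2).exp.aestronglyMeasurable (ae_of_all _ fun ω => by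
        rw [Real.norm_eq_abs, Real.abs_exp]
        exact hle ω)
    have hz : ∫ ω, (g (ξ 0 ω) - e) ∂μ = 0 := by
      rw [integral_sub hg0 (integrable_const e), integral_const]
      simp [he]
    obtain ⟨h1, h2⟩ := mgf_le_of_centered hm0 (hg0.sub (integrable_const e)) hz hex ht
    refine ⟨h1, h2.trans (Real.exp_le_exp.mpr ?_)⟩
    have := integral_mono hex hdom hle
    gcongr
  refine measure_sum_ge_le (Z := fun i ω => g (ξ i ω) - e)
    (hind.comp (fun _ x => g x - e) fun _ => hgm) (fun i => hgm.comp (hξ i))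
    (by positivity) (fun i t ht => ?_) n hτ0 hτ
  have hidi : IdentDistrib (fun ω => g (ξ i ω) - e) (fun ω => g (ξ 0 ω) - e) μ μ :=
    (hid i).comp hgm
  obtain ⟨h1, h2⟩ := hZ0 t ht
  refine ⟨?_, (mgf_congr_of_identDistrib _ _ hidi t).trans_le h2⟩
  exact ((hidi.comp (measurable_const_mul t)).comp Real.measurable_exp).integrable_iff.mpr h1

/-- The residual of a target is orthogonal to the function class. -/
lemma IsTarget.integral_residual_mul {X Y : Ω → ℝ} {F : Submodule ℝ (ℝ → ℝ)} {f₀ : ℝ → ℝ}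
    (h : IsTarget μ X Y F f₀) (hr : MemLp (fun ω => Y ω - f₀ (X ω)) 2 μ) {f : ℝ → ℝ} (hf : f ∈ F)
    (hf2 : MemLp (fun ω => f (X ω)) 2 μ) : ∫ ω, (Y ω - f₀ (X ω)) * f (X ω) ∂μ = 0 := by
  set B := ∫ ω, (Y ω - f₀ (X ω)) * f (X ω) ∂μ with hB
  set Q := ∫ ω, f (X ω) ^ 2 ∂μ with hQ
  have hi : Integrable (fun ω => (Y ω - f₀ (X ω)) * f (X ω)) μ := hr.integrable_mul hf2
  have key : ∀ t : ℝ, 2 * t * B ≤ t ^ 2 * Q := by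
    intro t
    have ht := h.2 (f₀ + t • f) (F.add_mem h.1 (F.smul_mem t hf))
    have : risk μ X Y (f₀ + t • f) = risk μ X Y f₀ - 2 * t * B + t ^ 2 * Q := by
      unfold risk
      have hi1 : Integrable (fun ω => (Y ω - f₀ (X ω)) ^ 2 -
          2 * t * ((Y ω - f₀ (X ω)) * f (X ω))) μ := hr.integrable_sq.sub (hi.const_mul _)
      rw [hB, hQ, ← integral_const_mul, ← integral_const_mul,
        ← integral_sub hr.integrable_sq (hi.const_mul _),
        ← integral_add hi1 (hf2.integrable_sq.const_mul _)]
      refine integral_congr_ae (ae_of_all _ fun ω => ?_)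
      simp only [Pi.add_apply, Pi.smul_apply, smul_eq_mul]
      ring
    linarith
  have hQ0 : 0 ≤ Q := integral_nonneg fun ω => sq_nonneg _
  -- First-order optimality along the line `f₀ + t f`. Near-optimal `t` is `B / Q`; adding 1 avoids
  -- the case `Q = 0` and still forces `B = 0`.
  have h1 := key (B / (Q + 1))
  have e1 : B / (Q + 1) * (Q + 1) = B := div_mul_cancel₀ _ (by positivity)
  set u := B / (Q + 1)
  rw [← e1] at h1
  have h2 : u ^ 2 * (Q + 2) ≤ 0 := by nlinarith
  have h3 : u ^ 2 ≤ 0 := by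
    by_contra hcon
    push Not at hcon
    nlinarith
  rw [← e1, pow_eq_zero_iff two_ne_zero |>.mp (le_antisymm h3 (sq_nonneg u)), zero_mul]

end

/-! ### The oracle inequality for the sample -/

lemma lin_mem {p : ℕ} {F : Submodule ℝ (ℝ → ℝ)} {ψ : Fin p → ℝ → ℝ} (hψ : ∀ j, ψ j ∈ F)
    (b : Fin p → ℝ) : lin ψ b ∈ F := by
  have : lin ψ b = ∑ j, b j • ψ j := by
    ext x
    simp [lin]
  rw [this]
  exact F.sum_mem fun j _ => F.smul_mem _ (hψ j)

lemma abs_sum_mul_le {p : ℕ} (b w : Fin p → ℝ) {τ : ℝ} (hw : ∀ j, |w j| ≤ τ) :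
    |∑ j, b j * w j| ≤ τ * l1 b := by
  unfold l1
  rw [Finset.mul_sum]
  refine (Finset.abs_sum_le_sum_abs _ _).trans (Finset.sum_le_sum fun j _ => ?_)
  rw [abs_mul, mul_comm]
  exact mul_le_mul_of_nonneg_right (hw j) (abs_nonneg _)

lemma lin_sq {p : ℕ} (ψ : Fin p → ℝ → ℝ) (b : Fin p → ℝ) (x : ℝ) :
    lin ψ b x ^ 2 = ∑ j, b j * ∑ k, b k * (ψ j x * ψ k x) := by
  unfold lin
  rw [sq, Finset.sum_mul]
  refine Finset.sum_congr rfl fun j _ => ?_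
  rw [Finset.mul_sum, Finset.mul_sum]
  exact Finset.sum_congr rfl fun k _ => by ring

section

variable {Ω : Type*} [MeasurableSpace Ω] {μ : Measure Ω}

/-- The population and the empirical mean of a linear combination. -/
lemma mean_sub_le {p n : ℕ} (hn : 0 < n) {b : Fin p → ℝ} {τ : ℝ} {g : Fin p → ℕ → ℝ}
    {h : Fin p → Ω → ℝ} (hi : ∀ j, Integrable (h j) μ)
    (hdev : ∀ j, |∑ i ∈ Finset.range n, (g j i - ∫ ω, h j ω ∂μ)| ≤ n * τ) :
    |1 / (n : ℝ) * ∑ i ∈ Finset.range n, ∑ j, b j * g j i - ∫ ω, ∑ j, b j * h j ω ∂μ| ≤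
      τ * l1 b := by
  have hn' : (0 : ℝ) < n := by exact_mod_cast hn
  rw [integral_finsetSum _ fun j _ => (hi j).const_mul _]
  have : 1 / (n : ℝ) * ∑ i ∈ Finset.range n, ∑ j, b j * g j i - ∑ j, ∫ ω, b j * h j ω ∂μ =
      ∑ j, b j * (1 / (n : ℝ) * ∑ i ∈ Finset.range n, (g j i - ∫ ω, h j ω ∂μ)) := by
    rw [Finset.sum_comm, Finset.mul_sum, ← Finset.sum_sub_distrib]
    refine Finset.sum_congr rfl fun j _ => ?_
    rw [integral_const_mul, Finset.sum_sub_distrib, ← Finset.mul_sum, Finset.sum_const,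
      Finset.card_range, nsmul_eq_mul]
    field_simp
  rw [this]
  refine abs_sum_mul_le _ _ fun j => ?_
  rw [abs_mul, abs_of_pos (by positivity), one_div, inv_mul_le_iff₀ hn']
  exact hdev j

/-- On the event where the noise and the Gram matrix are close to their means, the elastic net
obeys the oracle inequality. -/
lemma oracle_bound {X Y : Ω → ℝ} {F : Submodule ℝ (ℝ → ℝ)} {f₀ : ℝ → ℝ}
    (htar : IsTarget μ X Y F f₀) (hres : MemLp (fun ω => Y ω - f₀ (X ω)) 2 μ)
    (hF : ∀ f ∈ F, MemLp (fun ω => f (X ω)) 2 μ) {n p : ℕ} (hn : 0 < n) {ψ : Fin p → ℝ → ℝ}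
    (hψ : ∀ j, ψ j ∈ F) {x y : ℕ → ℝ} {l τ G : ℝ} (hl : 0 < l) (hτ0 : 0 ≤ τ)
    (hτ : τ * (8 * (1 + G)) ≤ l) {b c : Fin p → ℝ} (hb : b ≠ 0) (hbG : b ∈ ball1 p G)
    (hc : IsElasticNet n x y ψ l (lam2 l b) (ball1 p G) c)
    (hφ : 0 < phiSqAt μ X ψ l (lam2 l b) b)
    (happrox : 3 / 2 * mse μ X (lin ψ b) f₀ ≤
      9 * l ^ 2 * ((supp b).card : ℝ) / phiSqAt μ X ψ l (lam2 l b) b)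
    (hnoise : ∀ j, |∑ i ∈ Finset.range n, ((y i - lin ψ b (x i)) * ψ j (x i) -
      ∫ ω, (Y ω - lin ψ b (X ω)) * ψ j (X ω) ∂μ)| ≤ n * τ)
    (hgram : ∀ j k, |∑ i ∈ Finset.range n, (ψ j (x i) * ψ k (x i) -
      ∫ ω, ψ j (X ω) * ψ k (X ω) ∂μ)| ≤ n * τ) :
    ∫ ω, lin ψ (c - b) (X ω) ^ 2 ∂μ ≤
        81 * l ^ 2 * (supp b).card / phiSqAt μ X ψ l (lam2 l b) b ∧
      l1 (c - b) ≤ 63 * l * (supp b).card / phiSqAt μ X ψ l (lam2 l b) b := by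
  have hψ2 := fun j => hF _ (hψ j)
  have hfb := hF _ (lin_mem hψ b)
  have hfΔ := hF _ (lin_mem hψ (c - b))
  have hf0 := hF _ htar.1
  have hYb : MemLp (fun ω => Y ω - lin ψ b (X ω)) 2 μ := by
    convert (hres.add hf0).sub hfb using 1
    ext ω
    simp
  set Q := ∫ ω, lin ψ (c - b) (X ω) ^ 2 ∂μ with hQ
  set N := ∫ ω, (Y ω - lin ψ b (X ω)) * lin ψ (c - b) (X ω) ∂μ with hN
  set Qn := 1 / (n : ℝ) * ∑ i ∈ Finset.range n, lin ψ (c - b) (x i) ^ 2 with hQn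
  set Nn := 1 / (n : ℝ) * ∑ i ∈ Finset.range n,
    (y i - lin ψ b (x i)) * lin ψ (c - b) (x i) with hNn
  -- Duality is applied twice, within each row of the Gram matrix and then across rows, whence the
  -- squared norm.
  have hdQ : |Qn - Q| ≤ τ * l1 (c - b) ^ 2 := by
    have hrow : ∀ j, |∑ i ∈ Finset.range n, (∑ k, (c - b) k * (ψ j (x i) * ψ k (x i)) -
        ∫ ω, ∑ k, (c - b) k * (ψ j (X ω) * ψ k (X ω)) ∂μ)| ≤ n * (τ * l1 (c - b)) := by
      intro j
      have hn' : (0 : ℝ) < n := by exact_mod_cast hn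
      have := mean_sub_le (μ := μ) hn (b := c - b) (g := fun k i => ψ j (x i) * ψ k (x i))
        (h := fun k ω => ψ j (X ω) * ψ k (X ω)) (fun k => (hψ2 j).integrable_mul (hψ2 k))
        (hgram j)
      rw [← inv_mul_le_iff₀ hn', ← abs_of_pos (inv_pos.mpr hn'), ← abs_mul]
      refine (le_of_eq ?_).trans this
      rw [Finset.sum_sub_distrib, Finset.sum_const, Finset.card_range, nsmul_eq_mul]
      congr 1
      field_simp
    have := mean_sub_le (μ := μ) hn (b := c - b)
      (g := fun j i => ∑ k, (c - b) k * (ψ j (x i) * ψ k (x i)))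
      (h := fun j ω => ∑ k, (c - b) k * (ψ j (X ω) * ψ k (X ω)))
      (fun j => integrable_finsetSum _ fun k _ =>
        ((hψ2 j).integrable_mul (hψ2 k)).const_mul _) hrow
    simp only [← lin_sq] at this
    rwa [sq (l1 _), ← mul_assoc]
  have hdN : |Nn - N| ≤ τ * l1 (c - b) := by
    have := mean_sub_le (μ := μ) hn (b := c - b)
      (g := fun j i => (y i - lin ψ b (x i)) * ψ j (x i))
      (h := fun j ω => (Y ω - lin ψ b (X ω)) * ψ j (X ω))
      (fun j => hYb.integrable_mul (hψ2 j)) hnoise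
    have e : ∀ r z : ℝ, ∑ j, (c - b) j * (r * ψ j z) = r * lin ψ (c - b) z := by
      intro r z
      unfold lin
      rw [Finset.mul_sum]
      exact Finset.sum_congr rfl fun j _ => by ring
    simpa only [e] using this
  have hbasic : Qn - 2 * Nn + l * l1 c + lam2 l b * l2 c ^ 2 ≤
      l * l1 b + lam2 l b * l2 b ^ 2 := by
    have h := hc.2 b hbG
    unfold enCrit at h
    have e : ∑ i ∈ Finset.range n, (y i - lin ψ c (x i)) ^ 2 =
        ∑ i ∈ Finset.range n, (y i - lin ψ b (x i)) ^ 2 -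
          2 * ∑ i ∈ Finset.range n, (y i - lin ψ b (x i)) * lin ψ (c - b) (x i) +
          ∑ i ∈ Finset.range n, lin ψ (c - b) (x i) ^ 2 := by
      rw [Finset.mul_sum, ← Finset.sum_sub_distrib, ← Finset.sum_add_distrib]
      refine Finset.sum_congr rfl fun i _ => ?_
      rw [lin_sub]
      ring
    rw [e] at h
    rw [hQn, hNn]
    linarith
  -- Write `Y - f_b = (Y - f₀) - (f_b - f₀)`. The first part is orthogonal to `f_Δ`; the second is
  -- split by `-2 x y ≤ 2 x² + y² / 2`.
  have hNe : 2 * N ≤ 2 * mse μ X (lin ψ b) f₀ + Q / 2 := by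
    have h0 := htar.integral_residual_mul hres (lin_mem hψ (c - b)) hfΔ
    have hi1 : Integrable (fun ω => (Y ω - f₀ (X ω)) * lin ψ (c - b) (X ω)) μ :=
      hres.integrable_mul hfΔ
    have hi2 : Integrable (fun ω => (lin ψ b (X ω) - f₀ (X ω)) ^ 2) μ :=
      (hfb.sub hf0).integrable_sq
    have hi3 : Integrable (fun ω => 2 * ((Y ω - f₀ (X ω)) * lin ψ (c - b) (X ω)) +
        2 * (lin ψ b (X ω) - f₀ (X ω)) ^ 2) μ := (hi1.const_mul 2).add (hi2.const_mul 2)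
    calc 2 * N = ∫ ω, 2 * ((Y ω - lin ψ b (X ω)) * lin ψ (c - b) (X ω)) ∂μ := by
          rw [integral_const_mul]
      _ ≤ ∫ ω, (2 * ((Y ω - f₀ (X ω)) * lin ψ (c - b) (X ω)) +
            2 * (lin ψ b (X ω) - f₀ (X ω)) ^ 2 + 1 / 2 * lin ψ (c - b) (X ω) ^ 2) ∂μ := by
          refine integral_mono ((hYb.integrable_mul hfΔ).const_mul 2)
            (hi3.add (hfΔ.integrable_sq.const_mul _)) fun ω => ?_
          have := sq_nonneg (2 * (lin ψ b (X ω) - f₀ (X ω)) + lin ψ (c - b) (X ω))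
          nlinarith
      _ = 2 * mse μ X (lin ψ b) f₀ + Q / 2 := by
          rw [integral_add hi3 (hfΔ.integrable_sq.const_mul _),
            integral_add (hi1.const_mul 2) (hi2.const_mul 2), integral_const_mul,
            integral_const_mul, integral_const_mul, h0]
          unfold mse
          ring
  refine oracle_inequality hl hb hφ hτ0 hbG hc.1 hτ hbasic ?_ ?_ hNe happrox
    (integral_nonneg fun ω => sq_nonneg _) fun hcone => ?_
  · linarith [(abs_le.mp hdQ).1]
  · linarith [(abs_le.mp hdN).2]
  · refine phiSq_mul_le μ X ψ _ _ ?_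
    rwa [coneC_lam2 hl hb]

lemma mse_le_two_mul {X : Ω → ℝ} {f g h : ℝ → ℝ} (hf : MemLp (fun ω => f (X ω)) 2 μ)
    (hg : MemLp (fun ω => g (X ω)) 2 μ) (hh : MemLp (fun ω => h (X ω)) 2 μ) :
    mse μ X f h ≤ 2 * mse μ X f g + 2 * mse μ X g h := by
  unfold mse
  have h1 : Integrable (fun ω => (f (X ω) - g (X ω)) ^ 2) μ := (hf.sub hg).integrable_sq
  have h2 : Integrable (fun ω => (g (X ω) - h (X ω)) ^ 2) μ := (hg.sub hh).integrable_sq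
  have h3 : Integrable (fun ω => (f (X ω) - h (X ω)) ^ 2) μ := (hf.sub hh).integrable_sq
  rw [← integral_const_mul, ← integral_const_mul,
    ← integral_add (h1.const_mul 2) (h2.const_mul 2)]
  refine integral_mono h3 ((h1.const_mul 2).add (h2.const_mul 2)) fun ω => ?_
  nlinarith [sq_nonneg (f (X ω) - g (X ω) - (g (X ω) - h (X ω)))]

end

/-! ### Growth rates of the tuning parameter -/

section Rates

lemma isBigO_cutoff (δ : ℝ) (hδ : 0 < δ) {e : ℝ} (he : 0 < e) :
    (fun n : ℕ => cutoff δ n) =O[atTop] fun n : ℕ => (n : ℝ) ^ e := by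
  refine IsBigO.of_bound (Real.sqrt (1 / (δ * e))) ?_
  filter_upwards [eventually_ge_atTop 1] with n hn
  have hn' : (0 : ℝ) ≤ n := Nat.cast_nonneg _
  rw [cutoff, Real.norm_eq_abs, abs_of_nonneg (Real.sqrt_nonneg _), Real.norm_eq_abs,
    abs_of_nonneg (by positivity)]
  have hlog := Real.log_le_rpow_div hn' (by positivity : 0 < 2 * e)
  have hsq : (n : ℝ) ^ (2 * e) = ((n : ℝ) ^ e) ^ 2 := by
    rw [mul_comm, Real.rpow_mul hn']
    norm_cast
  refine Real.sqrt_le_iff.mpr ⟨by positivity, ?_⟩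
  rw [mul_pow, Real.sq_sqrt (by positivity), ← hsq]
  calc _ ≤ 2 / δ * ((n : ℝ) ^ (2 * e) / (2 * e)) := by gcongr
    _ = _ := by field_simp

lemma tendsto_cutoff {δ : ℝ} (hδ : 0 < δ) : Tendsto (fun n : ℕ => cutoff δ n) atTop atTop :=
  Real.tendsto_sqrt_atTop.comp (((Real.tendsto_log_atTop.comp
    tendsto_natCast_atTop_atTop).const_mul_atTop (by positivity)))

lemma isBigO_rpow_natCast {u v : ℝ} (h : u ≤ v) :
    (fun n : ℕ => (n : ℝ) ^ u) =O[atTop] fun n : ℕ => (n : ℝ) ^ v := by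
  refine IsBigO.of_bound 1 ?_
  filter_upwards [eventually_ge_atTop 1] with n hn
  have hn' : (1 : ℝ) ≤ n := by exact_mod_cast hn
  rw [Real.norm_eq_abs, Real.norm_eq_abs, abs_of_nonneg (by positivity),
    abs_of_nonneg (by positivity), one_mul]
  exact Real.rpow_le_rpow_of_exponent_le hn' h

lemma isBigO_log_natCast {p : ℕ → ℕ} {a : ℝ} (ha : 0 < a) (hp : ∀ᶠ n in atTop, 2 ≤ p n)
    (hpO : (fun n => (p n : ℝ)) =O[atTop] (fun n : ℕ => Real.exp ((n : ℝ) ^ a))) :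
    (fun n => Real.log (p n)) =O[atTop] fun n : ℕ => (n : ℝ) ^ a := by
  obtain ⟨B, hB, hBp⟩ := hpO.exists_pos
  refine IsBigO.of_bound (|Real.log B| + 1) ?_
  filter_upwards [hp, hBp.bound, eventually_ge_atTop 1] with n hn hb hn1
  have hn' : (1 : ℝ) ≤ n := by exact_mod_cast hn1
  have hp' : (2 : ℝ) ≤ p n := by exact_mod_cast hn
  have hna : 1 ≤ (n : ℝ) ^ a := Real.one_le_rpow hn' ha.le
  rw [Real.norm_eq_abs, Real.norm_eq_abs, Real.abs_exp, abs_of_nonneg (by positivity)] at hb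
  have hlog := Real.log_le_log (by linarith) hb
  rw [Real.log_mul hB.ne' (Real.exp_ne_zero _), Real.log_exp] at hlog
  rw [Real.norm_eq_abs, Real.norm_eq_abs, abs_of_nonneg (Real.log_nonneg (by linarith)),
    abs_of_nonneg (zero_le_one.trans hna)]
  nlinarith [le_abs_self (Real.log B), abs_nonneg (Real.log B)]

lemma lam0_sq {d δ G K : ℝ} {FC : ℝ → ℝ} {n p : ℕ} (hp : 2 ≤ p) :
    lam0 d δ G K FC n p ^ 2 =
      d ^ 2 * (2 * (cutoff δ n + 2 * FC (cutoff δ n) + G * K)) ^ 2 * Real.log p / n := by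
  have : (2 : ℝ) ≤ p := by exact_mod_cast hp
  unfold lam0
  rw [mul_pow, mul_pow, Real.sq_sqrt
    (div_nonneg (Real.log_nonneg (by linarith)) (Nat.cast_nonneg _)), mul_div_assoc]

lemma tendsto_lam0_sq {d δ G K a b dt : ℝ} {FC : ℝ → ℝ} {p : ℕ → ℕ} (hδ : 0 < δ) (ha : 0 < a)
    (hdt : 0 ≤ dt) (hp : ∀ᶠ n in atTop, 2 ≤ p n)
    (hpO : (fun n => (p n : ℝ)) =O[atTop] (fun n : ℕ => Real.exp ((n : ℝ) ^ a)))
    (hFO : (fun n : ℕ => FC (cutoff δ n)) =O[atTop] (fun n : ℕ => (n : ℝ) ^ dt))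
    (h : a + b + 2 * dt < 1) :
    Tendsto (fun n : ℕ => lam0 d δ G K FC n (p n) ^ 2 * (n : ℝ) ^ b) atTop (𝓝 0) := by
  -- The slack in the exponents is `4 e`; the logarithm in the cutoff costs `2 e` of it through
  -- `D_n²`, leaving the rate `n ^ (-2 e)`.
  set e := (1 - a - b - 2 * dt) / 4 with he
  have he0 : 0 < e := by linarith
  have hD : (fun n : ℕ => 2 * (cutoff δ n + 2 * FC (cutoff δ n) + G * K)) =O[atTop]
      fun n : ℕ => (n : ℝ) ^ (dt + e) := by
    refine IsBigO.const_mul_left ?_ 2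
    refine (((isBigO_cutoff δ hδ he0).trans (isBigO_rpow_natCast (by linarith))).add
      ((hFO.trans (isBigO_rpow_natCast (by linarith))).const_mul_left 2)).add ?_
    have h1 : (fun _ : ℕ => G * K) =O[atTop] fun n : ℕ => (n : ℝ) ^ (0 : ℝ) := by
      simp only [Real.rpow_zero]
      exact isBigO_const_const _ one_ne_zero _
    exact h1.trans (isBigO_rpow_natCast (by linarith))
  have hall := (((hD.mul hD).const_mul_left (d ^ 2)).mul (isBigO_log_natCast ha hp hpO)).mul
    (isBigO_refl (fun n : ℕ => (n : ℝ) ^ (b - 1)) atTop)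
  have hlim : Tendsto (fun n : ℕ => (n : ℝ) ^ (-(2 * e))) atTop (𝓝 0) :=
    (tendsto_rpow_neg_atTop (by positivity)).comp tendsto_natCast_atTop_atTop
  refine IsBigO.trans_tendsto (hall.congr' ?_ ?_) hlim
  · filter_upwards [hp, eventually_ge_atTop 1] with n hn hn1
    have hn' : (0 : ℝ) < n := by exact_mod_cast hn1
    rw [lam0_sq hn, Real.rpow_sub hn', Real.rpow_one]
    ring
  · filter_upwards [eventually_ge_atTop 1] with n hn1
    have hn' : (0 : ℝ) < n := by exact_mod_cast hn1
    simp only [← Real.rpow_add hn']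
    congr 1
    rw [he]
    ring

end Rates

lemma tendsto_lam0 {d δ G K a dt : ℝ} {FC : ℝ → ℝ} {p : ℕ → ℕ} (hδ : 0 < δ) (ha : 0 < a)
    (hdt : 0 ≤ dt) (hp : ∀ᶠ n in atTop, 2 ≤ p n)
    (hpO : (fun n => (p n : ℝ)) =O[atTop] (fun n : ℕ => Real.exp ((n : ℝ) ^ a)))
    (hFO : (fun n : ℕ => FC (cutoff δ n)) =O[atTop] (fun n : ℕ => (n : ℝ) ^ dt))
    (h : a + 2 * dt < 1) :
    Tendsto (fun n : ℕ => lam0 d δ G K FC n (p n)) atTop (𝓝 0) := by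
  have h1 := (tendsto_lam0_sq (d := d) (G := G) (K := K) (b := 0) hδ ha hdt hp hpO hFO
    (by linarith)).sqrt
  simp only [Real.rpow_zero, mul_one, Real.sqrt_sq_eq_abs, Real.sqrt_zero] at h1
  exact (tendsto_zero_iff_abs_tendsto_zero _).mpr h1

/-! ### The event of high probability -/

section

variable {Ω : Type*} [MeasurableSpace Ω] {μ : Measure Ω}

lemma measurableSet_forall_abs_le {ι : Type*} [Countable ι] {S : ι → Ω → ℝ}
    (hS : ∀ i, Measurable (S i)) (u : ℝ) : MeasurableSet {ω | ∀ i, |S i ω| ≤ u} := by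
  rw [Set.ofPred_forall]
  exact MeasurableSet.iInter fun i => measurableSet_le (hS i).abs measurable_const

/-- The event that finitely many empirical sums deviate by at most `u` has probability at least
one minus the sum of the tail bounds. -/
lemma one_sub_le_measure_iInter [IsProbabilityMeasure μ] {ι : Type*} [Fintype ι] {S : ι → Ω → ℝ}
    (hS : ∀ i, Measurable (S i)) {u q : ℝ} (hq : ∀ i, μ.real {ω | u ≤ |S i ω|} ≤ q) :
    1 - Fintype.card ι * q ≤ μ.real {ω | ∀ i, |S i ω| ≤ u} := by
  have h1 : μ.real {ω | ∀ i, |S i ω| ≤ u}ᶜ ≤ Fintype.card ι * q := by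
    calc _ ≤ μ.real (⋃ i, {ω | u ≤ |S i ω|}) := by
          refine measureReal_mono fun ω hω => ?_
          simp only [Set.mem_compl_iff, Set.mem_ofPred_eq, not_forall, not_le] at hω
          obtain ⟨i, hi⟩ := hω
          exact Set.mem_iUnion.mpr ⟨i, hi.le⟩
      _ ≤ ∑ i, μ.real {ω | u ≤ |S i ω|} := measureReal_iUnion_fintype_le _
      _ ≤ ∑ _i : ι, q := Finset.sum_le_sum fun i _ => hq i
      _ = _ := by simp
  rw [probReal_compl_eq_one_sub (measurableSet_forall_abs_le hS u)] at h1
  linarith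

/-- There are events of probability tending to one on which the elastic net obeys the oracle
inequality. -/
lemma exists_oracle_event [IsProbabilityMeasure μ]
    {𝒳 : Set ℝ} {X Y ε : ℕ → Ω → ℝ} {f₀ : ℝ → ℝ}
    (hX : ∀ i, Measurable (X i)) (hY : ∀ i, Measurable (Y i))
    (hX𝒳 : ∀ i ω, X i ω ∈ 𝒳) (hmodel : ∀ i ω, Y i ω = f₀ (X i ω) + ε i ω)
    (hindep : iIndepFun (fun i ω => (X i ω, Y i ω)) μ)
    (hident : ∀ i, IdentDistrib (fun ω => (X i ω, Y i ω)) (fun ω => (X 0 ω, Y 0 ω)) μ μ)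
    {F : Submodule ℝ (ℝ → ℝ)} (hF : ∀ f ∈ F, Measurable f ∧ MemLp (fun ω => f (X 0 ω)) 2 μ)
    (hf₀ : IsTarget μ (X 0) (Y 0) F f₀) {α δ : ℝ} (hα : 0 < α) (hδ : 0 < δ)
    (hsubε : SubGauss μ (ε 0) α δ) {FC : ℝ → ℝ} (hFC : ∀ C : ℝ, 0 < C → 0 ≤ FC C)
    {K G d η κ : ℝ} (hd : 0 < d) (hη : 0 < η) (hκ : 0 < κ)
    {p : ℕ → ℕ} (hp : ∀ᶠ n in atTop, 2 ≤ p n)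
    {ψ : ∀ n, Fin (p n) → ℝ → ℝ} (hψF : ∀ n j, ψ n j ∈ F)
    (hψK : ∀ᶠ n in atTop, ∀ j, ∀ x ∈ 𝒳, |ψ n j x| ≤ K) {l : ℕ → ℝ}
    (hl : ∀ᶠ n in atTop, 8 * lam0 d δ G K FC n (p n) ≤ l n) (hl0 : Tendsto l atTop (𝓝 0))
    {βs : ∀ n, Fin (p n) → ℝ} (hβsG : ∀ᶠ n in atTop, βs n ∈ ball1 (p n) G)
    (hβs : ∀ᶠ n in atTop, βs n ≠ 0) {βh : ∀ n, Ω → Fin (p n) → ℝ}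
    (hβh : ∀ᶠ n in atTop, ∀ ω, IsElasticNet n (fun i => X i ω) (fun i => Y i ω) (ψ n) (l n)
        (lam2 (l n) (βs n)) (ball1 (p n) G) (βh n ω))
    (hφ : ∀ᶠ n in atTop, κ ≤ phiSqAt μ (X 0) (ψ n) (l n) (lam2 (l n) (βs n)) (βs n))
    (hsup : ∀ᶠ n in atTop, ∀ x ∈ 𝒳, |lin (ψ n) (βs n) x - f₀ x| ≤ η / 2)
    (happrox : ∀ᶠ n in atTop,
      3 / 2 * mse μ (X 0) (lin (ψ n) (βs n)) f₀ ≤ 9 * l n ^ 2 * ((supp (βs n)).card : ℝ) /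
          phiSqAt μ (X 0) (ψ n) (l n) (lam2 (l n) (βs n)) (βs n)) :
    ∃ A : ℕ → Set Ω, (∀ n, MeasurableSet (A n)) ∧ Tendsto (fun n => μ (A n)) atTop (𝓝 1) ∧
      ∀ᶠ n in atTop, 0 < l n ∧ ∀ ω ∈ A n,
        ∫ ω', lin (ψ n) (βh n ω - βs n) (X 0 ω') ^ 2 ∂μ ≤
            81 * l n ^ 2 * (supp (βs n)).card / κ ∧
          l1 (βh n ω - βs n) ≤ 63 * l n * (supp (βs n)).card / κ := by
  have hε : ε 0 = fun ω => Y 0 ω - f₀ (X 0 ω) := by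
    ext ω
    rw [hmodel 0 ω]
    ring
  have hεm : Measurable (ε 0) := by
    rw [hε]
    exact (hY 0).sub ((hF _ hf₀.1).1.comp (hX 0))
  have hint := fun r hr => hsubε.integrable_exp hεm hα hδ (r := r) hr
  have hres : MemLp (fun ω => Y 0 ω - f₀ (X 0 ω)) 2 μ := hε ▸ memLp_two_of_exp hεm hint
  have hξ : ∀ i, Measurable fun ω => (X i ω, Y i ω) := fun i => (hX i).prodMk (hY i)
  -- Envelope for both families: noise products are at most `K (|ε| + η / 2)` because `f*` is
  -- uniformly within `η / 2` of `f₀`, and Gram products at most `K²`.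
  obtain ⟨c, hc, hconc⟩ := exists_concentration hξ hindep hident hεm hint
    (A := |K| * (1 + η / 2) + K ^ 2) (by positivity)
  obtain ⟨ω₀⟩ : Nonempty Ω := nonempty_of_isProbabilityMeasure μ
  have hcut := (tendsto_cutoff hδ).eventually_ge_atTop 1
  have hG : 0 ≤ G := by
    obtain ⟨n, hn⟩ := hβsG.exists
    exact (l1_nonneg _).trans hn
  have hK : 0 ≤ K := by
    obtain ⟨n, hn, hn2⟩ := (hψK.and hp).exists
    exact (abs_nonneg _).trans (hn ⟨0, by omega⟩ _ (hX𝒳 0 ω₀))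
  set τ : ℕ → ℝ := fun n => l n / (8 * (1 + G)) with hτ
  set D : ℕ → ℝ := fun n => 2 * (cutoff δ n + 2 * FC (cutoff δ n) + G * K) with hD
  have hDtop : Tendsto D atTop atTop := by
    refine tendsto_atTop_mono' _ ?_ (tendsto_cutoff hδ)
    filter_upwards [hcut] with n hn
    have := hFC _ (zero_lt_one.trans_le hn)
    have := mul_nonneg hG hK
    rw [hD]
    linarith
  -- `M n * log p` is a lower bound for the exponent `n τ² / (4 c)`, obtained from `l ≥ 8 λ₀`.
  set M : ℕ → ℝ := fun n => d ^ 2 * D n ^ 2 / (4 * (1 + G) ^ 2 * c) with hM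
  have hMtop : Tendsto M atTop atTop :=
    (((tendsto_pow_atTop two_ne_zero).comp hDtop).const_mul_atTop
      (by positivity)).atTop_div_const (by positivity)
  have hτ0 : Tendsto τ atTop (𝓝 0) := by
    simpa using hl0.div_const (8 * (1 + G))
  have hlpos : ∀ᶠ n in atTop, 0 < l n := by
    filter_upwards [hl, hp, hDtop.eventually_gt_atTop 0, eventually_ge_atTop 1]
      with n hn hpn hDn hn1
    have : (2 : ℝ) ≤ p n := by exact_mod_cast hpn
    have hlog : 0 < Real.log (p n) := Real.log_pos (by linarith)
    have hn' : (0 : ℝ) < n := by exact_mod_cast hn1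
    have : 0 < lam0 d δ G K FC n (p n) :=
      mul_pos (mul_pos hd hDn) (Real.sqrt_pos.mpr (by positivity))
    linarith
  -- the noise and Gram functions, indexed jointly
  let g : ∀ n, Fin (p n) ⊕ (Fin (p n) × Fin (p n)) → ℝ × ℝ → ℝ := fun n i z =>
    Sum.elim (fun j => (z.2 - lin (ψ n) (βs n) z.1) * ψ n j z.1)
      (fun jk => ψ n jk.1 z.1 * ψ n jk.2 z.1) i
  have hgm : ∀ n i, Measurable (g n i) := by
    have hψm := fun n j => (hF _ (hψF n j)).1
    have hlm := fun n => (hF _ (lin_mem (hψF n) (βs n))).1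
    rintro n (j | jk)
    · exact (measurable_snd.sub ((hlm n).comp measurable_fst)).mul
        ((hψm n j).comp measurable_fst)
    · exact ((hψm n _).comp measurable_fst).mul ((hψm n _).comp measurable_fst)
  let S : ∀ n, Fin (p n) ⊕ (Fin (p n) × Fin (p n)) → Ω → ℝ := fun n i ω =>
    ∑ k ∈ Finset.range n, (g n i (X k ω, Y k ω) - ∫ ω', g n i (X 0 ω', Y 0 ω') ∂μ)
  have hSm : ∀ n i, Measurable (S n i) := fun n i =>
    Finset.measurable_sum _ fun k _ => ((hgm n i).comp (hξ k)).sub_const _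
  have hgA : ∀ᶠ n in atTop, ∀ i ω, |g n i (X 0 ω, Y 0 ω)| ≤
      (|K| * (1 + η / 2) + K ^ 2) * (1 + |ε 0 ω|) := by
    filter_upwards [hψK, hsup] with n hψn hsn
    rw [abs_of_nonneg hK]
    rintro (j | jk) ω
    · have h1 := hψn j _ (hX𝒳 0 ω)
      have h2 : |Y 0 ω - lin (ψ n) (βs n) (X 0 ω)| ≤ |ε 0 ω| + η / 2 := by
        have h3 := hsn _ (hX𝒳 0 ω)
        rw [hmodel 0 ω]
        have := abs_sub (ε 0 ω) (lin (ψ n) (βs n) (X 0 ω) - f₀ (X 0 ω))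
        have e : f₀ (X 0 ω) + ε 0 ω - lin (ψ n) (βs n) (X 0 ω) =
          ε 0 ω - (lin (ψ n) (βs n) (X 0 ω) - f₀ (X 0 ω)) := by ring
        rw [e]
        linarith
      calc |(Y 0 ω - lin (ψ n) (βs n) (X 0 ω)) * ψ n j (X 0 ω)|
          ≤ (|ε 0 ω| + η / 2) * K := by
            rw [abs_mul]
            gcongr
        _ ≤ _ := by
            have := abs_nonneg (ε 0 ω)
            have h4 : 0 ≤ K * (1 + η / 2 * |ε 0 ω|) + K ^ 2 * (1 + |ε 0 ω|) := by positivity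
            linarith
    · calc |ψ n jk.1 (X 0 ω) * ψ n jk.2 (X 0 ω)| ≤ K * K := by
            rw [abs_mul]
            exact mul_le_mul (hψn _ _ (hX𝒳 0 ω)) (hψn _ _ (hX𝒳 0 ω)) (abs_nonneg _) hK
        _ ≤ _ := by
            have := abs_nonneg (ε 0 ω)
            have h4 : 0 ≤ K * (1 + η / 2) * (1 + |ε 0 ω|) + K ^ 2 * |ε 0 ω| := by positivity
            linarith
  -- The event is defined by the data and `βs` only, so it is measurable whatever the selection
  -- `βh`.
  refine ⟨fun n => {ω | ∀ i, |S n i ω| ≤ n * τ n}, 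
    fun n => measurableSet_forall_abs_le (hSm n) _, ?_, ?_⟩
  · have hlow : ∀ᶠ n in atTop, 1 - 4 * Real.exp ((2 - M n) * Real.log 2) ≤
        μ.real {ω | ∀ i, |S n i ω| ≤ n * τ n} := by
      filter_upwards [hgA, hl, hlpos, hp, hτ0.eventually_le_const (by positivity : 0 < 2 * c),
        eventually_ge_atTop 1, hMtop.eventually_ge_atTop 2, hDtop.eventually_gt_atTop 0]
        with n hgn hln hl0n hpn hτn hn1 hMn hDn
      have hn' : (0 : ℝ) < n := by exact_mod_cast hn1
      have hp2 : (2 : ℝ) ≤ p n := by exact_mod_cast hpn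
      have hlogp : Real.log 2 ≤ Real.log (p n) := Real.log_le_log two_pos hp2
      have hlog2 : 0 < Real.log 2 := Real.log_pos one_lt_two
      have hτpos : 0 ≤ τ n := by positivity
      have hexpo : M n * Real.log (p n) ≤ n * τ n ^ 2 / (4 * c) := by
        have h0 : 0 ≤ 8 * lam0 d δ G K FC n (p n) := by
          have : 0 ≤ lam0 d δ G K FC n (p n) :=
            mul_nonneg (mul_nonneg hd.le hDn.le) (Real.sqrt_nonneg _)
          linarith
        have h1 : (8 * lam0 d δ G K FC n (p n)) ^ 2 ≤ l n ^ 2 := pow_le_pow_left₀ h0 hln 2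
        rw [mul_pow, lam0_sq hpn] at h1
        calc M n * Real.log (p n) =
            n * (8 ^ 2 * (d ^ 2 * D n ^ 2 * Real.log (p n) / n)) / (256 * (1 + G) ^ 2 * c) := by
              rw [hM]
              field_simp
              ring
          _ ≤ n * l n ^ 2 / (256 * (1 + G) ^ 2 * c) := by gcongr
          _ = _ := by
              rw [hτ]
              field_simp
              ring
      have h1 := one_sub_le_measure_iInter (μ := μ) (hSm n) fun i =>
        hconc (g n i) (hgm n i) (hgn i) n (τ n) hτpos hτn
      refine le_trans ?_ h1
      have hcard : (Fintype.card (Fin (p n) ⊕ (Fin (p n) × Fin (p n))) : ℝ) ≤ 2 * (p n) ^ 2 := by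
        simp only [Fintype.card_sum, Fintype.card_prod, Fintype.card_fin]
        push_cast
        nlinarith
      have hpexp : ((p n : ℝ)) ^ 2 = Real.exp (2 * Real.log (p n)) := by
        rw [mul_comm, Real.exp_mul, Real.exp_log (by linarith)]
        norm_cast
      have : (Fintype.card (Fin (p n) ⊕ (Fin (p n) × Fin (p n))) : ℝ) *
          (2 * Real.exp (-(n * τ n ^ 2 / (4 * c)))) ≤
          4 * Real.exp ((2 - M n) * Real.log 2) := by
        -- The total failure probability is at most `4 p ^ (2 - M)`. Replacing `p` by 2 shows that
        -- `M → ∞` suffices, even when `p` stays bounded.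
        calc _ ≤ 2 * (p n : ℝ) ^ 2 * (2 * Real.exp (-(M n * Real.log (p n)))) := by gcongr
          _ = 4 * Real.exp ((2 - M n) * Real.log (p n)) := by
              rw [hpexp, sub_mul, sub_eq_add_neg, Real.exp_add]
              ring
          _ ≤ _ := by
              have := mul_le_mul_of_nonneg_left hlogp (sub_nonneg.mpr hMn)
              gcongr 4 * Real.exp ?_
              linarith
      linarith
    have hlim : Tendsto (fun n => 1 - 4 * Real.exp ((2 - M n) * Real.log 2)) atTop (𝓝 1) := by
      have h1 : Tendsto (fun n => (2 - M n) * Real.log 2) atTop atBot :=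
        (tendsto_atBot_add_const_left _ 2
          (tendsto_neg_atTop_atBot.comp hMtop)).atBot_mul_const (Real.log_pos one_lt_two)
      have h2 := ((Real.tendsto_exp_atBot.comp h1).const_mul 4).const_sub 1
      simpa using h2
    have hreal : Tendsto (fun n => μ.real {ω | ∀ i, |S n i ω| ≤ n * τ n}) atTop (𝓝 1) :=
      tendsto_of_tendsto_of_tendsto_of_le_of_le' hlim tendsto_const_nhds hlow
        (Eventually.of_forall fun n => measureReal_le_one)
    rw [← ENNReal.ofReal_one]
    exact (ENNReal.tendsto_ofReal hreal).congr fun n => ofReal_measureReal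
  · filter_upwards [hlpos, hβs, hβsG, hβh, hφ, happrox, eventually_ge_atTop 1]
      with n hln hbn hbGn hhn hφn han hn1
    refine ⟨hln, fun ω hω => ?_⟩
    have hφ0 := hκ.trans_le hφn
    obtain ⟨h1, h2⟩ := oracle_bound hf₀ hres (fun f hf => (hF f hf).2) (n := n) hn1 (hψF n) hln
      (τ := τ n) (G := G) (by positivity)
      (le_of_eq (div_mul_cancel₀ _ (by positivity))) hbn hbGn (hhn ω) hφ0 han
      (fun j => hω (Sum.inl j)) (fun j k => hω (Sum.inr (j, k)))
    have hs0 : (0 : ℝ) ≤ (supp (βs n)).card := Nat.cast_nonneg _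
    exact ⟨h1.trans (div_le_div_of_nonneg_left
        (mul_nonneg (mul_nonneg (by norm_num) (sq_nonneg _)) hs0) hκ hφn),
      h2.trans (div_le_div_of_nonneg_left
        (mul_nonneg (mul_nonneg (by norm_num) hln.le) hs0) hκ hφn)⟩

end

/-! ### From the event to the two limits -/

lemma tendsto_iSup_ofReal {Ω : Type*} {A : ℕ → Set Ω} {f : ℕ → Ω → ℝ} {B : ℕ → ℝ}
    (hf : ∀ᶠ n in atTop, ∀ ω ∈ A n, f n ω ≤ B n) (hB : Tendsto B atTop (𝓝 0)) :
    Tendsto (fun n => ⨆ ω ∈ A n, ENNReal.ofReal (f n ω)) atTop (𝓝 0) := by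
  have hB' := ENNReal.tendsto_ofReal hB
  rw [ENNReal.ofReal_zero] at hB'
  refine tendsto_of_tendsto_of_tendsto_of_le_of_le' tendsto_const_nhds hB'
    (Eventually.of_forall fun _ => zero_le) ?_
  filter_upwards [hf] with n hn
  exact iSup₂_le fun ω hω => ENNReal.ofReal_le_ofReal (hn ω hω)

/-- A coefficient vector supported on `S_β` is controlled by its prediction error. -/
lemma l1_sub_le_of_supp_eq {Ω : Type*} [MeasurableSpace Ω] {μ : Measure Ω} {X : Ω → ℝ} {p : ℕ}
    {ψ : Fin p → ℝ → ℝ} {l κ : ℝ} {b c : Fin p → ℝ} (hl : 0 < l) (hb : b ≠ 0)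
    (hbc : supp b = supp c) (hκ : 0 < κ) (hφ : κ ≤ phiSqAt μ X ψ l (lam2 l b) b)
    (happrox : 3 / 2 * mse μ X (lin ψ b) (lin ψ c) ≤
      9 * l ^ 2 * ((supp b).card : ℝ) / phiSqAt μ X ψ l (lam2 l b) b) :
    l1 (b - c) ≤ 3 * l * (supp b).card / κ := by
  -- The difference lives on the common support, so it lies in the cone trivially.
  have hout : l1 (restr (supp b)ᶜ (b - c)) = 0 := by
    refine Finset.sum_eq_zero fun j _ => ?_
    by_cases hj : j ∈ supp b
    · simp [restr, hj]
    · have h1 : b j = 0 := by simpa [supp] using hj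
      have h2 : c j = 0 := by
        rw [hbc] at hj
        simpa [supp] using hj
      simp [restr, h1, h2]
  have hre : phiSqAt μ X ψ l (lam2 l b) b * l2 (restr (supp b) (b - c)) ^ 2 ≤
      ∫ ω, lin ψ (b - c) (X ω) ^ 2 ∂μ := by
    refine phiSq_mul_le μ X ψ _ _ ?_
    rw [hout, coneC_lam2 hl hb]
    exact mul_nonneg (by positivity) (l2_nonneg _)
  simp only [lin_sub] at hre
  change _ ≤ mse μ X (lin ψ b) (lin ψ c) at hre
  have hsplit := l1_restr_add_compl (supp b) (b - c)
  have hcs := l1_restr_le (supp b) (b - c)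
  have hs : Real.sqrt (supp b).card ^ 2 = (supp b).card := Real.sq_sqrt (Nat.cast_nonneg _)
  have hs0 := Real.sqrt_nonneg ((supp b).card : ℝ)
  rw [← hs] at happrox ⊢
  set v := l2 (restr (supp b) (b - c))
  set r := Real.sqrt ((supp b).card : ℝ)
  have h1 : 9 * l ^ 2 * r ^ 2 / phiSqAt μ X ψ l (lam2 l b) b ≤ 9 * l ^ 2 * r ^ 2 / κ :=
    div_le_div_of_nonneg_left (by positivity) hκ hφ
  have h2 := mul_le_mul_of_nonneg_right hφ (sq_nonneg v)
  have h0 : 0 ≤ 9 * l ^ 2 * r ^ 2 / κ := by positivity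
  have h3 : κ * v ^ 2 ≤ 9 * l ^ 2 * r ^ 2 / κ := by linarith
  have hv : v ≤ 3 * l * r / κ := by
    refine abs_le_of_sq_le_sq' ?_ (by positivity) |>.2
    rw [← le_div_iff₀' hκ] at h3
    refine h3.trans_eq ?_
    field_simp
    ring
  calc l1 (b - c) ≤ r * v := by linarith
    _ ≤ r * (3 * l * r / κ) := by gcongr
    _ = _ := by ring

end ENet

theorem corollary5
    {Ω : Type*} [MeasurableSpace Ω] (μ : Measure Ω) [IsProbabilityMeasure μ]
    -- the i.i.d. data `Y i = f₀ (X i) + ε i`, with `X i` in `𝒳 ⊆ ℝ`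
    (𝒳 : Set ℝ) (X Y ε : ℕ → Ω → ℝ) (f₀ : ℝ → ℝ)
    (hX : ∀ i, Measurable (X i)) (hY : ∀ i, Measurable (Y i))
    (hX𝒳 : ∀ i ω, X i ω ∈ 𝒳)
    (hmodel : ∀ i ω, Y i ω = f₀ (X i ω) + ε i ω)
    (hindep : iIndepFun (fun i ω => (X i ω, Y i ω)) μ)
    (hident : ∀ i, IdentDistrib (fun ω => (X i ω, Y i ω)) (fun ω => (X 0 ω, Y 0 ω)) μ μ)
    -- the function space and the target
    (F : Submodule ℝ (ℝ → ℝ))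
    (hF : ∀ f ∈ F, Measurable f ∧ MemLp (fun ω => f (X 0 ω)) 2 μ)
    (hf₀ : ENet.IsTarget μ (X 0) (Y 0) F f₀)
    -- sub-gaussian covariates and errors
    (α δ : ℝ) (hα : 0 < α) (hδ : 0 < δ)
    (hsubX : ENet.SubGauss μ (X 0) α δ) (hsubε : ENet.SubGauss μ (ε 0) α δ)
    -- local bound on the target
    (FC : ℝ → ℝ)
    (hFC : ∀ C : ℝ, 0 < C → 0 ≤ FC C ∧ ∀ x ∈ 𝒳, |x| ≤ C → |f₀ x| ≤ FC C)
    -- constants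
    (K G L d η κ : ℝ) (hL : 8 ≤ L) (hd : 0 < d) (hη : 0 < η) (hκ : 0 < κ)
    -- the dictionaries
    (p : ℕ → ℕ) (hp : ∀ᶠ n in atTop, 2 ≤ p n)
    (ψ : ∀ n, Fin (p n) → ℝ → ℝ) (hψF : ∀ n j, ψ n j ∈ F)
    (hψK : ∀ᶠ n in atTop, ∀ j, ∀ x ∈ 𝒳, |ψ n j x| ≤ K)
    (hψ2 : ∀ᶠ n : ℕ in atTop,
      (1 / (n : ℝ)) * ∑ i ∈ Finset.range n, (⨆ j, ∫ ω, ψ n j (X i ω) ^ 2 ∂μ) ≤ 1)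
    (hrank : ∀ᶠ n in atTop, (ENet.cov μ (X 0) (ψ n)).rank = p n)
    -- tuning parameter, oracle and estimator
    (l : ℕ → ℝ)
    (hl : ∀ᶠ n in atTop, 8 * ENet.lam0 d δ G K FC n (p n) ≤ l n ∧
      l n ≤ L * ENet.lam0 d δ G K FC n (p n))
    (Γ : ∀ n, Set (Finset (Fin (p n))))
    (βs : ∀ n, Fin (p n) → ℝ)
    (horacle : ∀ᶠ n in atTop,
      -- `λ₂` fixed at its final value, or substituted into the criterion
      ENet.IsOracle μ (X 0) (Y 0) f₀ (ψ n) (l n) (fun _ => ENet.lam2 (l n) (βs n))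
          (ENet.ball1 (p n) G) (Γ n) (βs n) ∨
        ENet.IsOracle μ (X 0) (Y 0) f₀ (ψ n) (l n) (fun β => ENet.lam2 (l n) β)
          (ENet.ball1 (p n) G) (Γ n) (βs n))
    (hβs : ∀ᶠ n in atTop, βs n ≠ 0)
    (βh : ∀ n, Ω → Fin (p n) → ℝ)
    (hβh : ∀ᶠ n in atTop, ∀ ω,
      ENet.IsElasticNet n (fun i => X i ω) (fun i => Y i ω) (ψ n) (l n)
        (ENet.lam2 (l n) (βs n)) (ENet.ball1 (p n) G) (βh n ω))
    -- quality of the oracle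
    (hφ : ∀ᶠ n in atTop, κ ≤ ENet.phiSqAt μ (X 0) (ψ n) (l n) (ENet.lam2 (l n) (βs n)) (βs n))
    (hrec : ∀ᶠ n in atTop,
      36 * L ^ 2 * ENet.lam0 d δ G K FC n (p n) * ((ENet.supp (βs n)).card : ℝ) * K /
        (η * ENet.phiSqAt μ (X 0) (ψ n) (l n) (ENet.lam2 (l n) (βs n)) (βs n)) ≤ 1)
    (hsup : ∀ᶠ n in atTop, ∀ x ∈ 𝒳, |ENet.lin (ψ n) (βs n) x - f₀ x| ≤ η / 2)
    (happrox : ∀ᶠ n in atTop,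
      3 / 2 * ENet.mse μ (X 0) (ENet.lin (ψ n) (βs n)) f₀ ≤
        9 * l n ^ 2 * ((ENet.supp (βs n)).card : ℝ) /
          ENet.phiSqAt μ (X 0) (ψ n) (l n) (ENet.lam2 (l n) (βs n)) (βs n))
    -- growth rates
    (a b dt : ℝ) (ha : 0 < a) (hb : 0 ≤ b) (hdt : 0 ≤ dt)
    (hpO : (fun n => (p n : ℝ)) =O[atTop] (fun n : ℕ => Real.exp ((n : ℝ) ^ a)))
    (hFO : (fun n : ℕ => FC (ENet.cutoff δ n)) =O[atTop] (fun n : ℕ => (n : ℝ) ^ dt)) :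
    -- part a)
    ((fun n => ((ENet.supp (βs n)).card : ℝ)) =O[atTop] (fun n : ℕ => (n : ℝ) ^ b) →
      a + b + 2 * dt < 1 →
      ∃ A : ℕ → Set Ω, (∀ n, MeasurableSet (A n)) ∧
        Tendsto (fun n => μ (A n)) atTop (𝓝 1) ∧
        limsup (fun n => ⨆ ω ∈ A n,
            ENNReal.ofReal (ENet.mse μ (X 0) (ENet.lin (ψ n) (βh n ω)) f₀)) atTop ≤
          6 * limsup (fun n =>
            ENNReal.ofReal (ENet.mse μ (X 0) (ENet.lin (ψ n) (βs n)) f₀)) atTop) ∧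
    -- part b)
    (∀ (β₀ : ∀ n, Fin (p n) → ℝ) (s : ℕ),
      (∀ᶠ n in atTop, (∀ x ∈ 𝒳, f₀ x = ENet.lin (ψ n) (β₀ n) x) ∧
        β₀ n ∈ ENet.ball1 (p n) G ∧ (ENet.supp (β₀ n)).card ≤ s ∧
        Γ n = {ENet.supp (β₀ n)}) →
      a + 2 * dt < 1 →
      ∃ A : ℕ → Set Ω, (∀ n, MeasurableSet (A n)) ∧
        Tendsto (fun n => μ (A n)) atTop (𝓝 1) ∧
        Tendsto (fun n => ⨆ ω ∈ A n, ENNReal.ofReal (ENet.l1 (βh n ω - β₀ n))) atTop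
          (𝓝 0)) := by
  have hlam : a + 2 * dt < 1 → Tendsto l atTop (𝓝 0) := by
    intro h
    have h0 := ENet.tendsto_lam0 (d := d) (G := G) (K := K) hδ ha hdt hp hpO hFO h
    refine tendsto_of_tendsto_of_tendsto_of_le_of_le' ?_ ?_ (hl.mono fun n hn => hn.1)
      (hl.mono fun n hn => hn.2)
    · simpa using h0.const_mul 8
    · simpa using h0.const_mul L
  have hβsG : ∀ᶠ n in atTop, βs n ∈ ENet.ball1 (p n) G ∧ ENet.supp (βs n) ∈ Γ n :=
    horacle.mono fun n hn => hn.elim (fun h => ⟨h.1, h.2.1⟩) fun h => ⟨h.1, h.2.1⟩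
  have hevent := fun h : a + 2 * dt < 1 => ENet.exists_oracle_event hX hY hX𝒳 hmodel hindep hident
    hF hf₀ hα hδ hsubε (fun C hC => (hFC C hC).1) hd hη hκ hp hψF hψK (hl.mono fun n hn => hn.1)
    (hlam h) (hβsG.mono fun n hn => hn.1) hβs hβh hφ hsup happrox
  constructor
  · intro hs hab
    obtain ⟨A, hAm, hA1, hA⟩ := hevent (by linarith)
    refine ⟨A, hAm, hA1, ?_⟩
    have hl2 : (fun n => l n ^ 2) =O[atTop] fun n => ENet.lam0 d δ G K FC n (p n) ^ 2 := by
      refine IsBigO.of_bound (L ^ 2) ?_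
      filter_upwards [hl, hA] with n hn hAn
      rw [Real.norm_eq_abs, Real.norm_eq_abs, abs_of_nonneg (sq_nonneg _),
        abs_of_nonneg (sq_nonneg _), ← mul_pow]
      exact pow_le_pow_left₀ hAn.1.le hn.2 2
    -- `174 = 2 · 81 + 2 · 6`: twice the estimation bound plus twice the bound on the approximation
    -- error.
    have hlim : Tendsto (fun n => 174 / κ * (l n ^ 2 * ((ENet.supp (βs n)).card : ℝ))) atTop
        (𝓝 0) := by
      have := (hl2.mul hs).trans_tendsto (ENet.tendsto_lam0_sq hδ ha hdt hp hpO hFO hab)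
      simpa using this.const_mul (174 / κ)
    have hT : Tendsto (fun n => ⨆ ω ∈ A n,
        ENNReal.ofReal (ENet.mse μ (X 0) (ENet.lin (ψ n) (βh n ω)) f₀)) atTop (𝓝 0) := by
      refine ENet.tendsto_iSup_ofReal ?_ hlim
      filter_upwards [hA, happrox, hφ] with n hAn han hφn ω hω
      have hm := fun b => (hF _ (ENet.lin_mem (hψF n) b)).2
      have h1 := ENet.mse_le_two_mul (hm (βh n ω)) (hm (βs n)) (hF _ hf₀.1).2
      have h2 := (hAn.2 ω hω).1
      simp only [ENet.lin_sub] at h2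
      change ENet.mse μ (X 0) (ENet.lin (ψ n) (βh n ω)) (ENet.lin (ψ n) (βs n)) ≤ _ at h2
      have h3 := han.trans (div_le_div_of_nonneg_left (by positivity) hκ hφn)
      have e1 : 81 * l n ^ 2 * ((ENet.supp (βs n)).card : ℝ) / κ =
        81 / κ * (l n ^ 2 * ((ENet.supp (βs n)).card : ℝ)) := by ring
      have e2 : 9 * l n ^ 2 * ((ENet.supp (βs n)).card : ℝ) / κ =
        9 / κ * (l n ^ 2 * ((ENet.supp (βs n)).card : ℝ)) := by ring
      rw [e1] at h2
      rw [e2] at h3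
      linear_combination h1 + 2 * h2 + 4 / 3 * h3
    rw [hT.limsup_eq]
    exact zero_le
  · intro β₀ s hβ₀ hadt
    obtain ⟨A, hAm, hA1, hA⟩ := hevent hadt
    refine ⟨A, hAm, hA1, ENet.tendsto_iSup_ofReal (B := fun n => 66 * s / κ * l n) ?_ ?_⟩
    · filter_upwards [hA, hβ₀, hβsG, hβs, hφ, happrox] with n hAn hβ₀n hGn hβn hφn han ω hω
      obtain ⟨hlin, -, hcard, hΓ⟩ := hβ₀n
      -- The collection `Γ n` is a singleton, so the oracle has the true support, though its
      -- coefficients may differ from those of `β₀`.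
      have hsupp : ENet.supp (βs n) = ENet.supp (β₀ n) := by
        simpa [hΓ] using hGn.2
      have hmse : ENet.mse μ (X 0) (ENet.lin (ψ n) (βs n)) f₀ =
          ENet.mse μ (X 0) (ENet.lin (ψ n) (βs n)) (ENet.lin (ψ n) (β₀ n)) := by
        unfold ENet.mse
        simp only [hlin _ (hX𝒳 0 _)]
      rw [hmse] at han
      have h1 := ENet.l1_sub_le_of_supp_eq hAn.1 hβn hsupp hκ hφn han
      have h2 := (hAn.2 ω hω).2
      have h3 := ENet.l1_add_le (βh n ω - βs n) (βs n - β₀ n)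
      rw [sub_add_sub_cancel] at h3
      have hcs : ((ENet.supp (βs n)).card : ℝ) ≤ s := by
        rw [hsupp]
        exact_mod_cast hcard
      have hl0 := hAn.1
      calc _ ≤ 63 * l n * (ENet.supp (βs n)).card / κ +
            3 * l n * (ENet.supp (βs n)).card / κ := by linarith
        _ = 66 * (ENet.supp (βs n)).card / κ * l n := by ring
        _ ≤ _ := by gcongr
    · simpa using (hlam hadt).const_mul (66 * s / κ)
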